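/- Let $\mathcal V$ be a set of variables. A team $T$ is a finite set of assignments $s:\mathcal V\to M$ into some set $M$ of values, and $T[x]=\{s(x)\mid s\in T\}$ for a variable $x\in\mathcal V$. For variables $x,y$ and $n\in\mathbb N$, $T$ satisfies the unary quantity approximate inclusion atom $x\subseteq_n y$ iff $|T[x]\setminus T[y]|\le n$. For $p\in[0,1]\cap\mathbb Q$, $T$ satisfies the unary ratio approximate inclusion atom $x\subseteq_p y$ iff $|T[x]\setminus T[y]|\le p\,|T|$. For a set $\Sigma$ of atoms of one of these two kinds and an atom $\alpha$ of the same kind, write $\Sigma\models\alpha$ if every team (over any set $M$ of values) that satisfies all atoms of $\Sigma$ satisfies $\alpha$. Theorem. Each of the following two decision problems is in PTIME, where the variables are named by distinct binary strings, natural numbers (and the numerators and denominators of rationals) are written in binary, and $\Sigma$ is given as a list of its atoms: 1. given a finite set $\Sigma\cup\{x\subseteq_n y\}$ of unary quantity approximate inclusion atoms, decide whether $\Sigma\models x\subseteq_n y$; 2. given a finite set $\Sigma\cup\{x\subseteq_p y\}$ of unary ratio approximate inclusion atoms, decide whether $\Sigma\models x\subseteq_p y$. -/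

import Mathlib

namespace ApproxInclusion

/-- A team over the variables `V` with values in `M`: a finite set of assignments. -/
abbrev Team (V M : Type) : Type := Finset (V → M)

/-- The value set `T[x] = {s(x) | s ∈ T}` of a variable `x`. -/
def Team.values {V M : Type} (T : Team V M) (x : V) : Set M :=
  (fun s : V → M => s x) '' (T : Set (V → M))

/-- A unary approximate inclusion atom `lhs ⊆_approx rhs`, with approximations taken from `α`. -/
structure Atom (V α : Type) where
  lhs : V
  approx : α
  rhs : V

/-- The approximations of ratio atoms: rational numbers in `[0, 1]`. -/
abbrev Ratio : Type := {p : ℚ // 0 ≤ p ∧ p ≤ 1}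

/-- `T ⊨ x ⊆_n y` for a quantity approximate atom: `|T[x] \ T[y]| ≤ n`. -/
def SatQuantity {V M : Type} (T : Team V M) (a : Atom V ℕ) : Prop :=
  (T.values a.lhs \ T.values a.rhs).ncard ≤ a.approx

/-- `T ⊨ x ⊆_p y` for a ratio approximate atom: `|T[x] \ T[y]| ≤ p |T|`. -/
def SatRatio {V M : Type} (T : Team V M) (a : Atom V Ratio) : Prop :=
  ((T.values a.lhs \ T.values a.rhs).ncard : ℚ) ≤ (a.approx : ℚ) * (T.card : ℚ)

/-- `S ⊨ a` for quantity approximate atoms: every team, over every set of values, that satisfies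
all atoms of `S` satisfies `a`. -/
def EntailsQuantity {V : Type} (S : Set (Atom V ℕ)) (a : Atom V ℕ) : Prop :=
  ∀ (M : Type) (T : Team V M), (∀ b ∈ S, SatQuantity T b) → SatQuantity T a

/-- `S ⊨ a` for ratio approximate atoms. -/
def EntailsRatio {V : Type} (S : Set (Atom V Ratio)) (a : Atom V Ratio) : Prop :=
  ∀ (M : Type) (T : Team V M), (∀ b ∈ S, SatRatio T b) → SatRatio T a

/-- An input of the implication problem: a conclusion and a finite set of assumptions, which is
given as a list (in any order, repetitions allowed). -/
structure Input (V α : Type) where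
  goal : Atom V α
  assumptions : List (Atom V α)

/-- The finite set of assumptions of an input. -/
def Input.assumptionSet {V α : Type} (i : Input V α) : Set (Atom V α) :=
  {a | a ∈ i.assumptions}

/-! ### Inputs as words over a finite alphabet -/

open Computability in
/-- A bit string as a word over the alphabet `Γ'` (blank, two bits, two brackets, comma). -/
def bits (l : List Bool) : List Γ' := l.map Γ'.bit

open Computability in
/-- A natural number, written in binary. -/
def quantityWord (n : ℕ) : List Γ' := bits (encodeNat n)

open Computability in
/-- A ratio, written as its numerator and its denominator, both in binary. -/
def ratioWord (p : Ratio) : List Γ' :=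
  bits (encodeNat p.1.num.natAbs) ++ Γ'.comma :: bits (encodeNat p.1.den)

open Computability in
/-- The atom `x ⊆_p y` is written `[name of x, name of y, p]`. -/
def atomWord {V α : Type} (name : V → List Bool) (w : α → List Γ') (a : Atom V α) : List Γ' :=
  Γ'.bra :: (bits (name a.lhs) ++ Γ'.comma ::
    (bits (name a.rhs) ++ Γ'.comma :: (w a.approx ++ [Γ'.ket])))

open Computability in
/-- An input is written as its conclusion followed by its assumptions. -/
def inputWord {V α : Type} (name : V → List Bool) (w : α → List Γ') (i : Input V α) : List Γ' :=
  atomWord name w i.goal ++ i.assumptions.flatMap (atomWord name w)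

theorem append_sep_inj {β : Type} {c : β} : ∀ {u u' v v' : List β}, c ∉ u → c ∉ u' →
    u ++ c :: v = u' ++ c :: v' → u = u' ∧ v = v'
  | [], [], _, _, _, _, h => by simpa using h
  | [], b :: u', _, _, _, h2, h => by simp_all
  | a :: u, [], _, _, h1, _, h => by simp_all
  | a :: u, b :: u', v, v', h1, h2, h => by
    simp only [List.cons_append, List.cons.injEq] at h
    have := append_sep_inj (fun hc => h1 (List.mem_cons_of_mem _ hc))
      (fun hc => h2 (List.mem_cons_of_mem _ hc)) h.2
    exact ⟨by rw [h.1, this.1], this.2⟩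

theorem bits_injective : Function.Injective bits :=
  List.map_injective_iff.2 fun _ _ h => by simpa using h

theorem comma_notMem_bits (l : List Bool) : Computability.Γ'.comma ∉ bits l := by simp [bits]

theorem ket_notMem_bits (l : List Bool) : Computability.Γ'.ket ∉ bits l := by simp [bits]

theorem encodeNat_injective : Function.Injective Computability.encodeNat :=
  Computability.encodingNatBool.encode_injective

theorem quantityWord_injective : Function.Injective quantityWord :=
  bits_injective.comp encodeNat_injective

theorem ratioWord_injective : Function.Injective ratioWord := by
  rintro ⟨p, hp⟩ ⟨q, hq⟩ h
  obtain ⟨h1, h2⟩ := append_sep_inj (comma_notMem_bits _) (comma_notMem_bits _) h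
  have hn := encodeNat_injective (bits_injective h1)
  have hd := encodeNat_injective (bits_injective h2)
  have hp' : 0 ≤ p.num := Rat.num_nonneg.2 hp.1
  have hq' : 0 ≤ q.num := Rat.num_nonneg.2 hq.1
  simp only at hn hd
  have hnum : p.num = q.num := by omega
  exact Subtype.ext (Rat.ext hnum hd)

theorem atomWord_append_inj {V α : Type} {name : V → List Bool} (hname : Function.Injective name)
    {w : α → List Computability.Γ'} (hw : Function.Injective w)
    (hket : ∀ p, Computability.Γ'.ket ∉ w p) {a b : Atom V α} {l l' : List Computability.Γ'}
    (h : atomWord name w a ++ l = atomWord name w b ++ l') : a = b ∧ l = l' := by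
  simp only [atomWord, List.cons_append, List.append_assoc, List.cons.injEq, true_and,
    List.nil_append] at h
  obtain ⟨h1, h⟩ := append_sep_inj (comma_notMem_bits _) (comma_notMem_bits _) h
  obtain ⟨h2, h⟩ := append_sep_inj (comma_notMem_bits _) (comma_notMem_bits _) h
  obtain ⟨h3, h⟩ := append_sep_inj (hket _) (hket _) h
  have e1 := hname (bits_injective h1)
  have e2 := hname (bits_injective h2)
  have e3 := hw h3
  cases a
  cases b
  simp_all

theorem inputWord_injective {V α : Type} {name : V → List Bool} (hname : Function.Injective name)
    {w : α → List Computability.Γ'} (hw : Function.Injective w)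
    (hket : ∀ p, Computability.Γ'.ket ∉ w p) : Function.Injective (inputWord name w) := by
  rintro ⟨g, l⟩ ⟨g', l'⟩ h
  obtain ⟨rfl, h'⟩ := atomWord_append_inj hname hw hket h
  clear h
  have h : l.flatMap (atomWord name w) = l'.flatMap (atomWord name w) := h'
  clear h'
  suffices l = l' by rw [this]
  induction l generalizing l' with
  | nil =>
    cases l' with
    | nil => rfl
    | cons b l' => simp [atomWord] at h
  | cons a l ih =>
    cases l' with
    | nil => simp [atomWord] at h
    | cons b l' =>
      obtain ⟨rfl, h2⟩ := atomWord_append_inj hname hw hket (by simpa using h)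
      rw [ih l' h2]

/-- The encoding of the inputs with quantity approximate atoms; distinct variables are named by
distinct bit strings. -/
def quantityEncoding {V : Type} (name : V ↪ List Bool) : Input V ℕ ↪ List Computability.Γ' :=
  ⟨inputWord name quantityWord,
    inputWord_injective name.injective quantityWord_injective fun _ => ket_notMem_bits _⟩

/-- The encoding of the inputs with ratio approximate atoms. -/
def ratioEncoding {V : Type} (name : V ↪ List Bool) : Input V Ratio ↪ List Computability.Γ' :=
  ⟨inputWord name ratioWord,
    inputWord_injective name.injective ratioWord_injective fun _ => by
      simp [ratioWord, ket_notMem_bits]⟩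

open Classical in
/-- The decision problem `P`, whose inputs are written as words by `enc`, is in PTIME: some Turing
machine halts with the truth value of `P i` as its output on the word of every input `i`, within a
number of steps that is polynomial in the length of that word. -/
def InPTIME {ι Γ : Type} (enc : ι ↪ List Γ) (P : ι → Prop) : Prop :=
  Nonempty (Turing.TM2ComputableInPolyTime (fun i => enc i) Computability.encodeBool
    (fun i => decide (P i)))

end ApproxInclusion

/-! Both problems are shortest path problems. Read an atom `x ⊆ y` with approximation `w` as an edge
of weight `w` from `x` to `y`. Since `T[x] \ T[z] ⊆ (T[x] \ T[y]) ∪ (T[y] \ T[z])`, the weights of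
atoms add up along a walk, and so `Σ` entails `x ⊆ y` with approximation `p` if there is a walk from
`x` to `y` of total weight at most `p`; for ratio approximate atoms, it also does so if `1 ≤ p`,
because `T[x]` has at most as many elements as `T`. These are the only reasons for an entailment
(`entailsQuantity_iff`, `entailsRatio_iff`). For the converse, take the distance `g u` from each
variable `u` to `y`, as a multiple of a common denominator `D`, and capped at a number that still
violates the goal (`exists_potential`), and let `u` take as values the numbers below `g u`, up to
scaling and the values that keep these sets nonempty. These sets form a chain, and the triangle
inequality for the distance says that the team satisfies `Σ`. For ratio approximate atoms, the cap
is `D`, and the team needs `D` times the scaling factor as its number of assignments. To make so many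
assignments distinct, `y` gets several values; since they are fewer than the scaling factor, the goal
is still violated.

Distances are computed by the algorithm of Bellman and Ford (`distances`), whose estimates are
fractions that are not reduced. As many rounds as there are atoms are enough, since a shortest walk
need not leave a vertex twice (`Represents.lookup_distances_iff`). The estimates stay of polynomial
length, because each relaxation adds at most as many bits as the input has, up to a constant.

For the bound on the running time, programs are written in a small language of structured stack
programs, which `Prog.code` compiles to Turing machines, step by step. The programs compute
functions on binary trees, which are kept on a stack in prefix notation. The functions that can be
computed in this way in polynomial time (`PolyTime`) are closed under composition, pairing, case
distinctions, and folds over lists whose intermediate results are of polynomial size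
(`PolyTime.foldl_of_bound`). This suffices for the arithmetic of binary numbers, for the parser, and
for the algorithm. -/

open Function

namespace ApproxInclusion

/-! ### Structured stack programs and their compilation to Turing machines -/

/-- Structured programs over stacks indexed by `K` with alphabet `A` and one register, which holds
the last symbol that was popped, or `none` if that stack was empty. -/
inductive Prog (K A : Type) : Type
  | push (k : K) (f : Option A → A)
  | pop (k : K)
  | seq (p q : Prog K A)
  | ite (c : Option A → Bool) (p q : Prog K A)
  | loop (c : Option A → Bool) (p : Prog K A)

namespace Prog

variable {K A : Type}

/-- The content of the register and of the stacks. -/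
abbrev State (K A : Type) : Type := Option A × (K → List A)

/-- `Exec p s n s'`: started in `s`, the program `p` ends in `s'` after at most `n` steps. -/
inductive Exec [DecidableEq K] : Prog K A → State K A → ℕ → State K A → Prop
  | push {k f r S} : Exec (push k f) (r, S) 1 (r, update S k (f r :: S k))
  | pop {k r S} : Exec (pop k) (r, S) 1 ((S k).head?, update S k (S k).tail)
  | seq {p q s m s' n s''} : Exec p s m s' → Exec q s' n s'' → Exec (seq p q) s (m + n) s''
  | ite_true {c p q s n s'} : c s.1 = true → Exec p s n s' → Exec (ite c p q) s (n + 1) s'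
  | ite_false {c p q s n s'} : c s.1 = false → Exec q s n s' → Exec (ite c p q) s (n + 1) s'
  | loop_false {c p s} : c s.1 = false → Exec (loop c p) s 1 s
  | loop_true {c p s m s' n s''} : c s.1 = true → Exec p s m s' → Exec (loop c p) s' n s'' →
      Exec (loop c p) s (m + n + 1) s''
  | mono {p s m n s'} : Exec p s m s' → m ≤ n → Exec p s n s'

/-- The labels of the machine code of a program. -/
def Label : Prog K A → Type
  | push _ _ => Unit
  | pop _ => Unit
  | seq p q => Label p ⊕ Label q
  | ite _ p q => Option (Label p ⊕ Label q)
  | loop _ p => Option (Label p)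

/-- Programs have finitely many labels. -/
@[reducible]
def labelFintype : (p : Prog K A) → Fintype (Label p)
  | push _ _ => inferInstanceAs (Fintype Unit)
  | pop _ => inferInstanceAs (Fintype Unit)
  | seq p q => @instFintypeSum _ _ (labelFintype p) (labelFintype q)
  | ite _ p q => @instFintypeOption _ (@instFintypeSum _ _ (labelFintype p) (labelFintype q))
  | loop _ p => @instFintypeOption _ (labelFintype p)

/-- The label at which a program starts. -/
def entry : (p : Prog K A) → Label p
  | push _ _ => ()
  | pop _ => ()
  | seq p _ => Sum.inl (entry p)
  | ite _ _ _ => none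
  | loop _ _ => none

/-- The alphabets of the machine: there is one more stack, which holds the output. -/
abbrev Alphabet (K A : Type) : Option K → Type
  | none => Bool
  | some _ => A

/-- The stacks of a program and the output stack, as the stacks of the machine. -/
def machineStacks (S : K → List A) (o : List Bool) : (k : Option K) → List (Alphabet K A k)
  | none => o
  | some k => S k

/-- The machine code of a program as part of a machine with labels in `L`: its own labels are
embedded by `emb`, and it leaves to the label `exit`. -/
def code {L : Type} : (p : Prog K A) → (emb : Label p → L) → (exit : L) → Label p →
    Turing.TM2.Stmt (Alphabet K A) L (Option A)
  | push k f, _, exit => fun _ => .push (some k) f (.goto fun _ => exit)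
  | pop k, _, exit => fun _ => .pop (some k) (fun _ x => x) (.goto fun _ => exit)
  | seq p q, emb, exit => fun l =>
      match l with
      | .inl l => code p (fun l => emb (.inl l)) (emb (.inr (entry q))) l
      | .inr l => code q (fun l => emb (.inr l)) exit l
  | ite c p q, emb, exit => fun l =>
      match l with
      | none => .goto fun r =>
          cond (c r) (emb (some (.inl (entry p)))) (emb (some (.inr (entry q))))
      | some (.inl l) => code p (fun l => emb (some (.inl l))) exit l
      | some (.inr l) => code q (fun l => emb (some (.inr l))) exit l
  | loop c p, emb, exit => fun l =>
      match l with
      | none => .goto fun r => cond (c r) (emb (some (entry p))) exit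
      | some l => code p (fun l => emb (some l)) (emb none) l

variable [DecidableEq K]

theorem update_machineStacks (S : K → List A) (o : List Bool) (k : K) (x : List A) :
    update (machineStacks S o) (some k) x = machineStacks (update S k x) o := by
  funext j
  cases j with
  | none => rfl
  | some j =>
    by_cases h : j = k
    · subst h; simp [machineStacks]
    · have : (some j : Option K) ≠ some k := by simpa using h
      simp [machineStacks, h, this]

/-- Machine code runs like its program. -/
theorem Exec.evals {L : Type} {M : L → Turing.TM2.Stmt (Alphabet K A) L (Option A)}
    {p : Prog K A} {s s' : State K A} {n : ℕ} (h : Exec p s n s') (o : List Bool) :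
    ∀ (emb : Label p → L) (exit : L), (∀ l, M (emb l) = code p emb exit l) →
    Nonempty (StateTransition.EvalsToInTime (Turing.TM2.step M)
      ⟨some (emb (entry p)), s.1, machineStacks s.2 o⟩
      (some ⟨some exit, s'.1, machineStacks s'.2 o⟩) n) := by
  -- a single machine step, at a label whose statement is known
  have one : ∀ {l : L} {q r S c'}, M l = q → Turing.TM2.stepAux q r (machineStacks S o) = c' →
      StateTransition.EvalsToInTime (Turing.TM2.step M) ⟨some l, r, machineStacks S o⟩
        (some c') 1 := by
    rintro l q r S c' rfl rfl
    exact ⟨⟨1, rfl⟩, le_rfl⟩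
  induction h with
  | push =>
    intro emb exit h
    refine ⟨one (h ()) ?_⟩
    simp only [code, Turing.TM2.stepAux, ← update_machineStacks]
    rfl
  | pop =>
    intro emb exit h
    refine ⟨one (h ()) ?_⟩
    simp only [code, Turing.TM2.stepAux, ← update_machineStacks]
    rfl
  | seq _ _ ih₁ ih₂ =>
    intro emb exit h
    obtain ⟨h₁⟩ := ih₁ (fun l => emb (.inl l)) (emb (.inr (entry _))) fun l => h (.inl l)
    obtain ⟨h₂⟩ := ih₂ (fun l => emb (.inr l)) exit fun l => h (.inr l)
    have := h₁.trans _ _ _ _ _ _ h₂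
    rw [add_comm] at this
    exact ⟨this⟩
  | ite_true hc _ ih =>
    intro emb exit h
    obtain ⟨h₁⟩ := ih (fun l => emb (some (.inl l))) exit fun l => h (some (.inl l))
    exact ⟨(one (h none) (by simp only [code, Turing.TM2.stepAux, hc, cond_true])).trans
      _ _ _ _ _ _ h₁⟩
  | ite_false hc _ ih =>
    intro emb exit h
    obtain ⟨h₁⟩ := ih (fun l => emb (some (.inr l))) exit fun l => h (some (.inr l))
    exact ⟨(one (h none) (by simp only [code, Turing.TM2.stepAux, hc, cond_false])).trans
      _ _ _ _ _ _ h₁⟩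
  | loop_false hc =>
    intro emb exit h
    exact ⟨one (h none) (by simp only [code, Turing.TM2.stepAux, hc, cond_false])⟩
  | @loop_true c p s m s' n s'' hc _ _ ih₁ ih₂ =>
    intro emb exit h
    obtain ⟨h₁⟩ := ih₁ (fun l => emb (some l)) (emb none) fun l => h (some l)
    obtain ⟨h₂⟩ := ih₂ emb exit h
    have := ((one (r := s.1) (S := s.2) (h none)
      (by simp only [code, Turing.TM2.stepAux, hc, cond_true])).trans _ _ _ _ _ _ h₁).trans
      _ _ _ _ _ _ h₂
    exact ⟨⟨this.toEvalsTo, this.steps_le_m.trans (by omega)⟩⟩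
  | mono _ hmn ih =>
    intro emb exit h
    obtain ⟨h₁⟩ := ih emb exit h
    exact ⟨⟨h₁.toEvalsTo, h₁.steps_le_m.trans hmn⟩⟩

end Prog

/-! ### Binary trees on a stack -/

/-- Binary trees, the universal data type of the computations below. -/
inductive Data : Type
  | nil
  | node (l r : Data)

namespace Data

/-- The left subtree. -/
def left : Data → Data
  | nil => nil
  | node l _ => l

/-- The right subtree. -/
def right : Data → Data
  | nil => nil
  | node _ r => r

/-- Whether a tree is a node. -/
def isNode : Data → Bool
  | nil => false
  | node _ _ => true

open Computability in
/-- A tree in prefix notation, with the bits `1` for a node and `0` for a leaf. This is a prefix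
code, so that trees that are stored one after the other on a stack can be told apart. -/
def word : Data → List Γ'
  | nil => [Γ'.bit false]
  | node l r => Γ'.bit true :: (l.word ++ r.word)

/-- The length of the prefix notation. -/
def size (t : Data) : ℕ := t.word.length

@[simp] theorem size_nil : size nil = 1 := rfl

@[simp] theorem size_node (l r : Data) : size (node l r) = l.size + r.size + 1 := by
  simp [size, word]

theorem one_le_size (t : Data) : 1 ≤ t.size := by cases t <;> simp

end Data

/-- The stacks of the programs on trees: the word that is read, the main stack, two auxiliary
stacks, and a unary counter. -/
inductive Stk : Type
  | inp | main | aux₁ | aux₂ | cnt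
  deriving DecidableEq

instance : Fintype Stk :=
  ⟨{.inp, .main, .aux₁, .aux₂, .cnt}, fun k => by cases k <;> simp⟩

/-- Stacks with given contents. -/
def conf (i m a b c : List Computability.Γ') : Stk → List Computability.Γ'
  | .inp => i
  | .main => m
  | .aux₁ => a
  | .aux₂ => b
  | .cnt => c

namespace Prog

open Computability

section conf

variable {i m a b c x : List Γ'}

@[simp] theorem update_conf_inp : update (conf i m a b c) .inp x = conf x m a b c := by
  funext k; cases k <;> rfl

@[simp] theorem update_conf_main : update (conf i m a b c) .main x = conf i x a b c := by
  funext k; cases k <;> rfl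

@[simp] theorem update_conf_aux₁ : update (conf i m a b c) .aux₁ x = conf i m x b c := by
  funext k; cases k <;> rfl

@[simp] theorem update_conf_aux₂ : update (conf i m a b c) .aux₂ x = conf i m a x c := by
  funext k; cases k <;> rfl

@[simp] theorem update_conf_cnt : update (conf i m a b c) .cnt x = conf i m a b x := by
  funext k; cases k <;> rfl

end conf

theorem exec_push {k : Stk} {f : Option Γ' → Γ'} {r : Option Γ'} {S S' : Stk → List Γ'}
    (h : update S k (f r :: S k) = S') : Exec (push k f) (r, S) 1 (r, S') := h ▸ .push

theorem exec_pop {k : Stk} {r r' : Option Γ'} {S S' : Stk → List Γ'}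
    (h : (S k).head? = r') (h' : update S k (S k).tail = S') :
    Exec (pop k) (r, S) 1 (r', S') := h ▸ h' ▸ .pop

theorem Exec.cast {p : Prog Stk Γ'} {r r' : Option Γ'} {S T S' T' : Stk → List Γ'} {n : ℕ}
    (h : Exec p (r, S) n (r', S')) (hS : S = T) (hS' : S' = T') : Exec p (r, T) n (r', T') :=
  hS ▸ hS' ▸ h

/-- Empties the stack `x` onto the stack `y`, which reverses the order. -/
def moveAll (x y : Stk) : Prog Stk Γ' :=
  seq (pop x) (loop Option.isSome (seq (push y fun r => r.getD .blank) (pop x)))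

theorem exec_moveAll {x y : Stk} (hxy : x ≠ y) {r : Option Γ'} {S S' : Stk → List Γ'}
    (h : update (update S x []) y ((S x).reverse ++ S y) = S') :
    Exec (moveAll x y) (r, S) (3 * (S x).length + 2) (none, S') := by
  have key : ∀ (l : List Γ') (S : Stk → List Γ'), S x = l.tail →
      Exec (loop Option.isSome (seq (push y fun r => r.getD .blank) (pop x))) (l.head?, S)
        (3 * l.length + 1) (none, update (update S x []) y (l.reverse ++ S y)) := by
    intro l
    induction l with
    | nil =>
      intro S hS
      have e : update (update S x []) y (([] : List Γ').reverse ++ S y) = S := by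
        funext k
        by_cases h1 : k = y
        · subst h1; simp
        · by_cases h2 : k = x
          · subst h2; simpa [h1] using hS.symm
          · simp [h1, h2]
      rw [e]
      exact .loop_false rfl
    | cons z l ih =>
      intro S hS
      have := ih (update (update S y (z :: S y)) x l.tail) (by simp)
      refine .mono (.loop_true rfl (.seq .push (exec_pop (r' := l.head?) ?_ rfl))
        (this.cast ?_ ?_)) (m := 1 + 1 + (3 * l.length + 1) + 1) (by simp; omega)
      · simp [update_of_ne hxy, hS]
      · simp [update_of_ne hxy, hS]
      · funext k
        by_cases h1 : k = y
        · subst h1; simp [Ne.symm hxy]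
        · by_cases h2 : k = x
          · subst h2; simp [h1]
          · simp [h1, h2]
  refine .mono (.seq .pop ((key (S x) (update S x (S x).tail) (by simp)).cast rfl ?_))
    (m := 1 + (3 * (S x).length + 1)) (by omega)
  rw [← h]
  funext k
  by_cases h1 : k = y
  · subst h1; simp [Ne.symm hxy]
  · by_cases h2 : k = x
    · subst h2; simp [h1]
    · simp [h1, h2]

/-- Empties the stack `x`. -/
def clear (x : Stk) : Prog Stk Γ' :=
  seq (pop x) (loop Option.isSome (pop x))

theorem exec_clear {x : Stk} {r : Option Γ'} {S S' : Stk → List Γ'} (h : update S x [] = S') :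
    Exec (clear x) (r, S) (2 * (S x).length + 2) (none, S') := by
  have key : ∀ (l : List Γ') (S : Stk → List Γ'), S x = l.tail →
      Exec (loop Option.isSome (pop x)) (l.head?, S) (2 * l.length + 1) (none, update S x []) := by
    intro l
    induction l with
    | nil =>
      intro S hS
      rw [show update S x [] = S by rw [← hS.trans List.tail_nil, update_eq_self]]
      exact .loop_false rfl
    | cons z l ih =>
      intro S hS
      have := ih (update S x l.tail) (by simp)
      rw [update_idem] at this
      exact .mono (.loop_true rfl (exec_pop (by rw [hS]; rfl) (by rw [hS]; rfl)) this)
        (by simp; omega)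
  have := key (S x) (update S x (S x).tail) (by simp)
  rw [update_idem, h] at this
  exact .mono (.seq .pop this) (by omega)

/-- The loop of `moveTree`. The counter has one symbol for each subtree that is still to be read
after the current one. -/
def moveTreeLoop (y : Stk) : Prog Stk Γ' :=
  loop Option.isSome (seq (pop .main)
    (ite (fun r => decide (r = some (.bit true)))
      (seq (push y fun _ => .bit true) (push .cnt fun _ => .blank))
      (seq (push y fun _ => .bit false) (pop .cnt))))

/-- Moves the tree on top of the main stack, in reversed prefix notation, to the stack `y`. The push
and the pop at the start fill the register, so that the loop is entered. -/
def moveTree (y : Stk) : Prog Stk Γ' :=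
  seq (push .cnt fun _ => .blank) (seq (pop .cnt) (moveTreeLoop y))

/-- Reading one tree: the rest of the loop starts with the next symbol of the counter. -/
theorem exec_moveTreeLoop {y : Stk} (hm : y ≠ .main) (hc : y ≠ .cnt) (t : Data) :
    ∀ {n : ℕ} {z : Γ'} {rest c : List Γ'} {S : Stk → List Γ'} {s' : State Stk Γ'},
    S .main = t.word ++ rest → S .cnt = c →
    Exec (moveTreeLoop y) (c.head?, update (update (update S .main rest) y
      (t.word.reverse ++ S y)) .cnt c.tail) n s' →
    Exec (moveTreeLoop y) (some z, S) (5 * t.size + n) s' := by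
  induction t with
  | nil =>
    intro n z rest c S s' h1 h2 h
    refine .mono (.loop_true rfl (.seq (exec_pop (r' := some (.bit false)) ?_ rfl)
      (.ite_false rfl (.seq .push (exec_pop (r' := c.head?) ?_ rfl)))) ?_)
      (m := 1 + (1 + 1 + 1) + n + 1) (by simp)
    · rw [h1]; rfl
    · simp [hc.symm, h2]
    · obtain ⟨r', S'⟩ := s'
      refine h.cast ?_ rfl
      funext k
      cases k <;> cases y <;> simp_all [Data.word]
  | node l r ihl ihr =>
    intro n z rest c S s' h1 h2 h
    refine .mono (.loop_true rfl (.seq (exec_pop (r' := some (.bit true)) ?_ rfl)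
      (.ite_true rfl (.seq .push .push))) ?_)
      (m := 1 + (1 + 1 + 1) + (5 * l.size + (5 * r.size + n)) + 1) (by simp; omega)
    · rw [h1]; rfl
    · refine ihl (rest := r.word ++ rest) (c := .blank :: c) ?_ ?_
        (ihr (rest := rest) (c := c) ?_ ?_ ?_)
      · cases y <;> simp_all [Data.word]
      · cases y <;> simp_all [Data.word]
      · cases y <;> simp_all [Data.word]
      · cases y <;> simp_all [Data.word]
      · obtain ⟨r', S'⟩ := s'
        refine h.cast ?_ rfl
        funext k
        cases k <;> cases y <;> simp_all [Data.word]

theorem exec_moveTree {y : Stk} (hm : y ≠ .main) (hc : y ≠ .cnt) (t : Data) {r : Option Γ'}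
    {rest : List Γ'} {S S' : Stk → List Γ'} (h1 : S .main = t.word ++ rest) (h2 : S .cnt = [])
    (h : update (update S .main rest) y (t.word.reverse ++ S y) = S') :
    Exec (moveTree y) (r, S) (5 * t.size + 3) (none, S') := by
  refine .mono (.seq .push (.seq (exec_pop (r' := some .blank) ?_ rfl)
    (exec_moveTreeLoop hm hc t (rest := rest) (c := []) (n := 1) ?_ ?_ ?_)))
    (m := 1 + (1 + (5 * t.size + 1))) (by omega)
  · simp
  · simpa using h1
  · simp [h2]
  · subst h
    refine (Exec.loop_false rfl).cast rfl ?_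
    funext k
    cases k <;> cases y <;> simp_all

end Prog

/-! ### Programs that transform trees -/

namespace Prog

open Computability

/-- `Runs p t u n`: the program `p` replaces the tree `t` on top of the main stack by the tree `u`
within `n` steps, and leaves the rest of the main stack alone. The other stacks are empty at the
start and at the end. -/
def Runs (p : Prog Stk Γ') (t u : Data) (n : ℕ) : Prop :=
  ∀ (rest : List Γ') (r : Option Γ'), ∃ r', Exec p (r, conf [] (t.word ++ rest) [] [] []) n
    (r', conf [] (u.word ++ rest) [] [] [])

theorem Runs.seq {p q : Prog Stk Γ'} {t u v : Data} {m n : ℕ} (h : Runs p t u m)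
    (h' : Runs q u v n) : Runs (p.seq q) t v (m + n) := fun rest r =>
  let ⟨_, h1⟩ := h rest r
  let ⟨r'', h2⟩ := h' rest _
  ⟨r'', .seq h1 h2⟩

theorem Runs.mono {p : Prog Stk Γ'} {t u : Data} {m n : ℕ} (h : Runs p t u m) (hmn : m ≤ n) :
    Runs p t u n := fun rest r =>
  let ⟨r', h1⟩ := h rest r
  ⟨r', .mono h1 hmn⟩

/-- The test whether the register holds the code of a node. -/
def isNode (r : Option Γ') : Bool := decide (r = some (.bit true))

/-- Replaces a tree by its left subtree. -/
def leftProg : Prog Stk Γ' :=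
  seq (pop .main) (ite isNode
    (seq (moveTree .aux₁) (seq (moveTree .aux₂) (seq (clear .aux₂) (moveAll .aux₁ .main))))
    (push .main fun _ => .bit false))

theorem runs_leftProg (t : Data) : Runs leftProg t t.left (15 * t.size) := by
  intro rest r
  cases t with
  | nil =>
    exact ⟨_, .mono (.seq (exec_pop (r' := some (.bit false)) rfl rfl)
      (.ite_false rfl (exec_push (by simp [conf, Data.left, Data.word])))) (by simp)⟩
  | node t u =>
    refine ⟨none, .mono (.seq (exec_pop (r' := some (.bit true))
      (S' := conf [] (t.word ++ (u.word ++ rest)) [] [] []) rfl ?_) (.ite_true rfl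
      (.seq (exec_moveTree (S' := conf [] (u.word ++ rest) t.word.reverse [] [])
        (by simp) (by simp) t (rest := u.word ++ rest) rfl rfl ?_)
      (.seq (exec_moveTree (S' := conf [] rest t.word.reverse u.word.reverse [])
        (by simp) (by simp) u (rest := rest) rfl rfl ?_)
      (.seq (exec_clear (S' := conf [] rest t.word.reverse [] []) ?_)
        (exec_moveAll (by simp) ?_)))))) ?_⟩
    all_goals simp [conf, Data.word, Data.left]
    have := t.one_le_size
    have := u.one_le_size
    simp only [Data.size] at *
    omega

/-- Replaces a tree by its right subtree. -/
def rightProg : Prog Stk Γ' :=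
  seq (pop .main) (ite isNode (seq (moveTree .aux₁) (clear .aux₁))
    (push .main fun _ => .bit false))

theorem runs_rightProg (t : Data) : Runs rightProg t t.right (15 * t.size) := by
  intro rest r
  cases t with
  | nil =>
    exact ⟨_, .mono (.seq (exec_pop (r' := some (.bit false)) rfl rfl)
      (.ite_false rfl (exec_push (by simp [conf, Data.right, Data.word])))) (by simp)⟩
  | node t u =>
    refine ⟨none, .mono (.seq (exec_pop (r' := some (.bit true))
      (S' := conf [] (t.word ++ (u.word ++ rest)) [] [] []) rfl ?_) (.ite_true rfl
      (.seq (exec_moveTree (S' := conf [] (u.word ++ rest) t.word.reverse [] [])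
        (by simp) (by simp) t (rest := u.word ++ rest) rfl rfl ?_)
      (exec_clear ?_)))) ?_⟩
    all_goals simp [conf, Data.word, Data.right]
    have := t.one_le_size
    have := u.one_le_size
    simp only [Data.size] at *
    omega

/-- Puts a fixed tree on top of the main stack. -/
def pushData : Data → Prog Stk Γ'
  | .nil => push .main fun _ => .bit false
  | .node l r => seq (pushData r) (seq (pushData l) (push .main fun _ => .bit true))

theorem exec_pushData (t : Data) (i m : List Γ') (r : Option Γ') :
    Exec (pushData t) (r, conf i m [] [] []) t.size (r, conf i (t.word ++ m) [] [] []) := by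
  induction t generalizing m with
  | nil => exact exec_push (by simp [conf, Data.word])
  | node t u iht ihu =>
    exact .mono (.seq (ihu m) (.seq (iht _) (exec_push (by simp [conf, Data.word]))))
      (by simp; omega)

/-- Replaces a tree by a fixed tree. -/
def constProg (u : Data) : Prog Stk Γ' :=
  seq (moveTree .aux₁) (seq (clear .aux₁) (pushData u))

theorem runs_constProg (t u : Data) : Runs (constProg u) t u (15 * t.size + u.size) := by
  intro rest r
  refine ⟨none, .mono (.seq (exec_moveTree (S' := conf [] rest t.word.reverse [] [])
    (by simp) (by simp) t (rest := rest) rfl rfl (by simp [conf]))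
    (.seq (exec_clear (S' := conf [] rest [] [] []) (by simp)) (exec_pushData u [] rest _))) ?_⟩
  have := t.one_le_size
  simp [conf, Data.size] at *
  omega

/-- Copies the content of the register and of the first auxiliary stack both to the main stack and
to the second auxiliary stack. -/
def copyLoop : Prog Stk Γ' :=
  loop Option.isSome (seq (push .main fun r => r.getD .blank)
    (seq (push .aux₂ fun r => r.getD .blank) (pop .aux₁)))

theorem exec_copyLoop (l : List Γ') (m b : List Γ') :
    Exec copyLoop (l.head?, conf [] m l.tail b []) (4 * l.length + 1)
      (none, conf [] (l.reverse ++ m) [] (l.reverse ++ b) []) := by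
  induction l generalizing m b with
  | nil => exact .loop_false rfl
  | cons z l ih =>
    refine .mono (.loop_true rfl (.seq (exec_push (S' := conf [] (z :: m) l b []) (by simp [conf]))
      (.seq (exec_push (S' := conf [] (z :: m) l (z :: b) []) (by simp [conf]))
      (exec_pop (r' := l.head?) (S' := conf [] (z :: m) l.tail (z :: b) []) rfl
        (by simp [conf])))) ((ih (z :: m) (z :: b)).cast rfl ?_))
      (m := 1 + (1 + 1) + (4 * l.length + 1) + 1) (by simp; omega)
    simp

/-- Puts a second copy of the tree on top of the main stack. -/
def dupProg : Prog Stk Γ' :=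
  seq (moveTree .aux₁) (seq (pop .aux₁) (seq copyLoop
    (seq (moveAll .aux₂ .aux₁) (moveAll .aux₁ .main))))

theorem exec_dupProg (t : Data) (rest : List Γ') (r : Option Γ') :
    Exec dupProg (r, conf [] (t.word ++ rest) [] [] []) (25 * t.size)
      (none, conf [] (t.word ++ (t.word ++ rest)) [] [] []) := by
  refine .mono (.seq (exec_moveTree (S' := conf [] rest t.word.reverse [] [])
    (by simp) (by simp) t (rest := rest) rfl rfl (by simp [conf])) (.seq (exec_pop rfl rfl)
    (.seq ((exec_copyLoop t.word.reverse rest []).cast (by simp [conf]) (by simp; rfl))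
    (.seq (exec_moveAll (S' := conf [] (t.word ++ rest) t.word.reverse [] []) (by simp)
      (by simp [conf])) (exec_moveAll (by simp) (by simp [conf])))))) ?_
  have := t.one_le_size
  simp [conf, Data.size] at *
  omega

/-- Exchanges the two topmost trees on the main stack. -/
def swapProg : Prog Stk Γ' :=
  seq (moveTree .aux₁) (seq (moveTree .aux₂) (seq (moveAll .aux₁ .main) (moveAll .aux₂ .main)))

theorem exec_swapProg (t u : Data) (rest : List Γ') (r : Option Γ') :
    Exec swapProg (r, conf [] (t.word ++ (u.word ++ rest)) [] [] []) (15 * t.size + 15 * u.size)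
      (none, conf [] (u.word ++ (t.word ++ rest)) [] [] []) := by
  refine .mono
    (.seq (exec_moveTree (S' := conf [] (u.word ++ rest) t.word.reverse [] [])
      (by simp) (by simp) t (rest := u.word ++ rest) rfl rfl ?_)
    (.seq (exec_moveTree (S' := conf [] rest t.word.reverse u.word.reverse [])
      (by simp) (by simp) u (rest := rest) rfl rfl ?_)
    (.seq (exec_moveAll (S' := conf [] (t.word ++ rest) [] u.word.reverse []) (by simp) ?_)
    (exec_moveAll (by simp) ?_)))) ?_
  all_goals simp [conf]
  have := t.one_le_size
  have := u.one_le_size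
  simp only [Data.size] at *
  omega

/-- Runs two programs on the same tree and pairs their results. -/
def pairProg (p q : Prog Stk Γ') : Prog Stk Γ' :=
  seq dupProg (seq q (seq swapProg (seq p (push .main fun _ => .bit true))))

theorem Runs.pairProg {p q : Prog Stk Γ'} {t u v : Data} {m n : ℕ} (hp : Runs p t u m)
    (hq : Runs q t v n) :
    Runs (pairProg p q) t (.node u v) (m + n + (40 * t.size + 15 * v.size + 1)) := by
  intro rest r
  obtain ⟨r₁, h₁⟩ := hq (t.word ++ rest) none
  obtain ⟨r₂, h₂⟩ := hp (v.word ++ rest) none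
  refine ⟨r₂, .mono (.seq (exec_dupProg t rest r) (.seq h₁ (.seq (exec_swapProg v t rest r₁)
    (.seq h₂ (exec_push ?_))))) ?_⟩
  · simp [conf, Data.word]
  · omega

/-- Runs `p` or `q`, according to the result of `c`, which is a leaf for `false` and a node with
two leaves for `true`. -/
def condProg (c p q : Prog Stk Γ') : Prog Stk Γ' :=
  seq dupProg (seq c (seq (pop .main) (ite isNode (seq (pop .main) (seq (pop .main) p)) q)))

theorem Runs.condProg_true {c p q : Prog Stk Γ'} {t u : Data} {m n : ℕ}
    (hc : Runs c t (.node .nil .nil) m) (hp : Runs p t u n) :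
    Runs (condProg c p q) t u (m + n + (25 * t.size + 4)) := by
  intro rest r
  obtain ⟨r₁, h₁⟩ := hc (t.word ++ rest) none
  obtain ⟨r₂, h₂⟩ := hp rest (some (.bit false))
  refine ⟨r₂, .mono (.seq (exec_dupProg t rest r) (.seq h₁ (.seq (exec_pop rfl rfl)
    (.ite_true rfl (.seq (exec_pop rfl rfl) (.seq (exec_pop rfl ?_) h₂)))))) ?_⟩
  · simp [conf, Data.word]
  · omega

theorem Runs.condProg_false {c p q : Prog Stk Γ'} {t u : Data} {m n : ℕ}
    (hc : Runs c t .nil m) (hq : Runs q t u n) :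
    Runs (condProg c p q) t u (m + n + (25 * t.size + 2)) := by
  intro rest r
  obtain ⟨r₁, h₁⟩ := hc (t.word ++ rest) none
  obtain ⟨r₂, h₂⟩ := hq rest (some (.bit false))
  refine ⟨r₂, .mono (.seq (exec_dupProg t rest r) (.seq h₁ (.seq (exec_pop rfl ?_)
    (.ite_false rfl h₂)))) ?_⟩
  · simp [conf, Data.word]
  · omega

/-- Loads the second symbol of a node into the register, that is, the first symbol of its left
subtree. -/
def peekLeft : Prog Stk Γ' :=
  seq (pop .main) (seq (pop .main) (seq (push .main fun r => r.getD .blank)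
    (push .main fun _ => .bit true)))

theorem exec_peekLeft (t u : Data) (rest : List Γ') (r : Option Γ') :
    Exec peekLeft (r, conf [] ((Data.node t u).word ++ rest) [] [] []) 4
      (t.word.head?, conf [] ((Data.node t u).word ++ rest) [] [] []) := by
  refine .seq (exec_pop rfl rfl) (.seq (exec_pop (r' := t.word.head?) ?_ rfl)
    (.seq (exec_push rfl) (exec_push ?_)))
  · cases t <;> simp [conf, Data.word]
  · cases t <;> simp [conf, Data.word]

/-- Runs `p` as long as the left subtree is a node. -/
def whileProg (p : Prog Stk Γ') : Prog Stk Γ' :=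
  seq peekLeft (loop isNode (seq p peekLeft))

end Prog

/-! ### Functions that are computable in polynomial time -/

/-- An encoding of the elements of a type as trees. -/
class Enc (α : Type) where
  /-- The encoding. -/
  enc : α → Data

/-- The size of the encoding of `a`. -/
def sz {α : Type} [Enc α] (a : α) : ℕ := (Enc.enc a).size

instance : Enc Data := ⟨id⟩

/-- The encoding of a pair is a node. -/
instance {α β : Type} [Enc α] [Enc β] : Enc (α × β) := ⟨fun x => .node (Enc.enc x.1) (Enc.enc x.2)⟩

instance : Enc Bool := ⟨fun b => cond b (.node .nil .nil) .nil⟩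

/-- The encoding of a list: a leaf for the empty list, and otherwise the pair of the head and the
tail. -/
def encList {α : Type} [Enc α] : List α → Data
  | [] => .nil
  | a :: l => .node (Enc.enc a) (encList l)

instance {α : Type} [Enc α] : Enc (List α) := ⟨encList⟩

/-- Natural numbers are encoded in binary, as the list of their bits. -/
instance : Enc ℕ := ⟨fun n => Enc.enc n.bits⟩

section size

variable {α β : Type} [Enc α] [Enc β]

theorem one_le_sz (a : α) : 1 ≤ sz a := Data.one_le_size _

@[simp] theorem sz_pair (a : α) (b : β) : sz (a, b) = sz a + sz b + 1 := Data.size_node _ _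

@[simp] theorem sz_nil : sz ([] : List α) = 1 := rfl

@[simp] theorem sz_cons (a : α) (l : List α) : sz (a :: l) = sz a + sz l + 1 := Data.size_node _ _

theorem sz_bool_le (b : Bool) : sz b ≤ 3 := by cases b <;> decide

theorem sz_nat (n : ℕ) : sz n = sz n.bits := rfl

theorem length_lt_sz (l : List α) : l.length < sz l := by
  induction l with
  | nil => simp
  | cons a l ih => simp; omega

theorem sz_le_of_mem {a : α} {l : List α} (h : a ∈ l) : sz a ≤ sz l := by
  induction l with
  | nil => simp at h
  | cons b l ih =>
    rcases List.mem_cons.1 h with rfl | h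
    · simp; omega
    · have := ih h; simp; omega

theorem sz_le_of_forall {l : List α} {m : ℕ} (h : ∀ a ∈ l, sz a ≤ m) :
    sz l ≤ l.length * (m + 1) + 1 := by
  induction l with
  | nil => simp
  | cons a l ih =>
    have h1 := ih fun b hb => h b (List.mem_cons_of_mem _ hb)
    have h2 := h a List.mem_cons_self
    simp only [sz_cons, List.length_cons, add_mul]
    omega

end size

/-- `g` is bounded by a polynomial in the size of its argument. -/
def PolyBounded {α : Type} [Enc α] (g : α → ℕ) : Prop :=
  ∃ p : Polynomial ℕ, ∀ a, g a ≤ p.eval (sz a)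

theorem eval_mono (p : Polynomial ℕ) {m n : ℕ} (h : m ≤ n) : p.eval m ≤ p.eval n := by
  induction p using Polynomial.induction_on' with
  | add p q hp hq => simpa using add_le_add hp hq
  | monomial k a => simpa using Nat.mul_le_mul_left a (Nat.pow_le_pow_left h k)

namespace PolyBounded

variable {α β : Type} [Enc α] [Enc β]

theorem mono {g h : α → ℕ} (hg : PolyBounded g) (hle : ∀ a, h a ≤ g a) : PolyBounded h :=
  let ⟨p, hp⟩ := hg
  ⟨p, fun a => (hle a).trans (hp a)⟩

theorem const (n : ℕ) : PolyBounded fun _ : α => n := ⟨Polynomial.C n, fun _ => by simp⟩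

theorem id : PolyBounded (sz : α → ℕ) := ⟨Polynomial.X, fun _ => by simp⟩

theorem add {g h : α → ℕ} (hg : PolyBounded g) (hh : PolyBounded h) :
    PolyBounded fun a => g a + h a :=
  let ⟨p, hp⟩ := hg
  let ⟨q, hq⟩ := hh
  ⟨p + q, fun a => by simpa using add_le_add (hp a) (hq a)⟩

theorem mul {g h : α → ℕ} (hg : PolyBounded g) (hh : PolyBounded h) :
    PolyBounded fun a => g a * h a :=
  let ⟨p, hp⟩ := hg
  let ⟨q, hq⟩ := hh
  ⟨p * q, fun a => by simpa using Nat.mul_le_mul (hp a) (hq a)⟩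

theorem eval (p : Polynomial ℕ) {g : α → ℕ} (hg : PolyBounded g) :
    PolyBounded fun a => p.eval (g a) :=
  let ⟨q, hq⟩ := hg
  ⟨p.comp q, fun a => by simpa using eval_mono p (hq a)⟩

theorem comp {g : β → ℕ} (hg : PolyBounded g) {f : α → β} (hf : PolyBounded fun a => sz (f a)) :
    PolyBounded fun a => g (f a) :=
  let ⟨p, hp⟩ := hg
  (eval p hf).mono fun a => hp (f a)

end PolyBounded

open Prog in
/-- `f` is computed in polynomial time by a program on the encodings. The bound for the size of the
values follows from the one for the time, but it is convenient to have it at hand. -/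
def PolyTime {α β : Type} [Enc α] [Enc β] (f : α → β) : Prop :=
  ∃ (p : Prog Stk Computability.Γ') (time : α → ℕ), PolyBounded time ∧
    PolyBounded (fun a => sz (f a)) ∧ ∀ a, Runs p (Enc.enc a) (Enc.enc (f a)) (time a)

namespace PolyTime

open Prog

variable {α β γ δ : Type} [Enc α] [Enc β] [Enc γ] [Enc δ]

theorem polyBounded {f : α → β} (hf : PolyTime f) : PolyBounded fun a => sz (f a) :=
  let ⟨_, _, _, h, _⟩ := hf
  h

theorem comp {g : β → γ} (hg : PolyTime g) {f : α → β} (hf : PolyTime f) :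
    PolyTime fun a => g (f a) :=
  let ⟨p, _, hs, hs', hp⟩ := hf
  let ⟨q, _, ht, ht', hq⟩ := hg
  ⟨p.seq q, _, hs.add (ht.comp hs'), ht'.comp hs', fun a => (hp a).seq (hq (f a))⟩

/-- Changing a function along types with the same encodings. -/
theorem congr_enc {f : α → β} (hf : PolyTime f) {g : γ → δ} (e : γ → α)
    (he : ∀ c, Enc.enc (e c) = Enc.enc c) (h : ∀ c, Enc.enc (g c) = Enc.enc (f (e c))) :
    PolyTime g := by
  obtain ⟨p, s, hs, hs', hp⟩ := hf
  have hsz : PolyBounded fun c => sz (e c) := PolyBounded.id.mono fun c => by simp [sz, he]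
  refine ⟨p, _, hs.comp hsz, (hs'.comp hsz).mono fun c => ?_, fun c => ?_⟩
  · simp [sz, h]
  · rw [h, ← he]
    exact hp (e c)

theorem left : PolyTime Data.left :=
  ⟨leftProg, _, (PolyBounded.const 15).mul .id, PolyBounded.id.mono fun t => by
    cases t <;> simp [sz, Enc.enc, Data.left]; omega, runs_leftProg⟩

theorem right : PolyTime Data.right :=
  ⟨rightProg, _, (PolyBounded.const 15).mul .id, PolyBounded.id.mono fun t => by
    cases t <;> simp [sz, Enc.enc, Data.right]; omega, runs_rightProg⟩

theorem const (b : β) : PolyTime fun _ : α => b :=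
  ⟨constProg (Enc.enc b), fun a => 15 * sz a + sz b,
    ((PolyBounded.const 15).mul .id).add (.const _), .const _, fun _ => runs_constProg _ _⟩

theorem pair {f : α → β} {g : α → γ} (hf : PolyTime f) (hg : PolyTime g) :
    PolyTime fun a => (f a, g a) := by
  obtain ⟨p, s, hs, hs', hp⟩ := hf
  obtain ⟨q, t, ht, ht', hq⟩ := hg
  refine ⟨pairProg p q, fun a => s a + t a + (40 * sz a + 15 * sz (g a) + 1),
    (hs.add ht).add ((((PolyBounded.const 40).mul .id).add ((PolyBounded.const 15).mul ht')).add
      (.const 1)), ?_, fun a => (hp a).pairProg (hq a)⟩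
  simpa using (hs'.add ht').add (.const 1)

theorem id : PolyTime fun a : α => a :=
  ⟨seq (push .cnt fun _ => .blank) (pop .cnt), fun _ => 2, .const _, .id, fun a rest r =>
    ⟨_, .seq (exec_push (S' := conf [] _ [] [] [_]) (by simp; rfl)) (exec_pop rfl (by simp; rfl))⟩⟩

theorem of_enc_eq {f : α → β} (h : ∀ a, Enc.enc (f a) = Enc.enc a) : PolyTime f :=
  (id (α := α)).congr_enc (fun a => a) (fun _ => rfl) h

theorem fst {f : α → β × γ} (hf : PolyTime f) : PolyTime fun a => (f a).1 :=
  (left.congr_enc (Enc.enc : β × γ → Data) (g := Prod.fst) (fun _ => rfl) fun _ => rfl).comp hf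

theorem snd {f : α → β × γ} (hf : PolyTime f) : PolyTime fun a => (f a).2 :=
  (right.congr_enc (Enc.enc : β × γ → Data) (g := Prod.snd) (fun _ => rfl) fun _ => rfl).comp hf

protected theorem cond {c : α → Bool} {f g : α → β} (hc : PolyTime c) (hf : PolyTime f)
    (hg : PolyTime g) : PolyTime fun a => cond (c a) (f a) (g a) := by
  obtain ⟨o, u, hu, -, ho⟩ := hc
  obtain ⟨p, s, hs, hs', hp⟩ := hf
  obtain ⟨q, t, ht, ht', hq⟩ := hg
  refine ⟨condProg o p q, fun a => u a + (s a + t a) + (25 * sz a + 4),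
    (hu.add (hs.add ht)).add (((PolyBounded.const 25).mul .id).add (.const _)),
    (hs'.add ht').mono fun a => by dsimp only; cases c a <;> simp, fun a => ?_⟩
  have ho := ho a
  dsimp only
  cases h : c a <;> rw [h] at ho
  · exact (ho.condProg_false (hq a)).mono (by simp only [sz]; omega)
  · exact (ho.condProg_true (hp a)).mono (by simp only [sz]; omega)

protected theorem ite {c : α → Prop} [DecidablePred c] {f g : α → β}
    (hc : PolyTime fun a => decide (c a)) (hf : PolyTime f) (hg : PolyTime g) :
    PolyTime fun a => if c a then f a else g a := by
  simpa [Bool.cond_decide] using hc.cond hf hg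

theorem and {f g : α → Bool} (hf : PolyTime f) (hg : PolyTime g) :
    PolyTime fun a => f a && g a := by
  simpa using hf.cond hg (const false)

theorem or {f g : α → Bool} (hf : PolyTime f) (hg : PolyTime g) :
    PolyTime fun a => f a || g a := by
  simpa using hf.cond (const true) hg

theorem not {f : α → Bool} (hf : PolyTime f) : PolyTime fun a => !f a := by
  simpa using hf.cond (const false) (const true)

theorem xor {f g : α → Bool} (hf : PolyTime f) (hg : PolyTime g) :
    PolyTime fun a => Bool.xor (f a) (g a) := by
  have : (fun a => Bool.xor (f a) (g a)) = fun a => cond (f a) (!g a) (g a) := by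
    funext a; cases f a <;> simp
  rw [this]
  exact hf.cond hg.not hg

theorem cons {f : α → β} {g : α → List β} (hf : PolyTime f) (hg : PolyTime g) :
    PolyTime fun a => f a :: g a :=
  (of_enc_eq (f := fun x : β × List β => x.1 :: x.2) fun _ => rfl).comp (hf.pair hg)

theorem tail {f : α → List β} (hf : PolyTime f) : PolyTime fun a => (f a).tail :=
  (right.congr_enc (Enc.enc : List β → Data) (g := List.tail) (fun _ => rfl)
    fun l => by cases l <;> rfl).comp hf

theorem isNode : PolyTime Data.isNode := by
  refine ⟨seq (pop .main) (seq (push .main fun r => r.getD .blank) (ite Prog.isNode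
    (constProg (.node .nil .nil)) (constProg .nil))), fun t => 15 * sz t + 6,
    ((PolyBounded.const 15).mul .id).add (.const _), (PolyBounded.const 3).mono fun t =>
      sz_bool_le _, fun t rest r => ?_⟩
  cases t with
  | nil =>
    obtain ⟨r', h⟩ := runs_constProg .nil .nil rest (some (.bit false))
    exact ⟨r', .mono (.seq (exec_pop rfl rfl) (.seq (exec_push (by simp [conf]; rfl))
      (.ite_false rfl h))) (m := 1 + (1 + (16 + 1))) (by simp [sz, Enc.enc])⟩
  | node t u =>
    obtain ⟨r', h⟩ := runs_constProg (.node t u) (.node .nil .nil) rest (some (.bit true))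
    exact ⟨r', .mono (.seq (exec_pop rfl rfl) (.seq (exec_push (by simp [conf]; rfl))
      (.ite_true rfl h))) (m := 1 + (1 + (15 * (Data.node t u).size + 3 + 1)))
      (by simp [sz, Enc.enc]; omega)⟩

theorem isEmpty {f : α → List β} (hf : PolyTime f) : PolyTime fun a => (f a).isEmpty := by
  have : PolyTime fun l : List β => !l.isEmpty :=
    isNode.congr_enc (Enc.enc : List β → Data) (fun _ => rfl)
      fun l => by cases l <;> simp [Enc.enc, encList, Data.isNode]
  simpa using (this.comp hf).not

theorem headD {f : α → List β} {g : α → β} (hf : PolyTime f) (hg : PolyTime g) :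
    PolyTime fun a => (f a).headD (g a) := by
  have : PolyTime fun x : Data × Data => cond (x.1.isNode) x.1.left x.2 :=
    (isNode.comp id.fst).cond (left.comp id.fst) id.snd
  have h2 : PolyTime fun x : List β × β => x.1.headD x.2 :=
    this.congr_enc (fun x : List β × β => (Enc.enc x.1, Enc.enc x.2)) (fun _ => rfl)
      fun x => by rcases x with ⟨_ | ⟨a, l⟩, b⟩ <;> simp [Enc.enc, encList, Data.isNode, Data.left]
  exact h2.comp (hf.pair hg)

/-- Iteration over a list: the accumulators have to stay polynomially bounded. -/
theorem foldl_of_bound {init : γ → β} {l : γ → List α} {step : γ → β → α → β}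
    (hi : PolyTime init) (hl : PolyTime l)
    (hs : PolyTime fun x : γ × β × α => step x.1 x.2.1 x.2.2) {B : γ → ℕ} (hB : PolyBounded B)
    (h : ∀ c l', l' <+: l c → sz (l'.foldl (step c) (init c)) ≤ B c) :
    PolyTime fun c => (l c).foldl (step c) (init c) := by
  -- one round, on states made of the rest of the list, the context and the accumulator
  have hbody : PolyTime fun x : (α × List α) × γ × β => (x.1.2, x.2.1, step x.2.1 x.2.2 x.1.1) :=
    id.fst.snd.pair (id.snd.fst.pair (hs.comp (id.snd.fst.pair (id.snd.snd.pair id.fst.fst))))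
  obtain ⟨p, t, ⟨q, hq⟩, -, hp⟩ := hbody
  have hloop : ∀ (c : γ) (M : ℕ) (l : List α) (b : β) (rest : List Computability.Γ'),
      (∀ l', l' <+: l → sz (l, c, l'.foldl (step c) b) ≤ M) →
      ∃ r', Exec (loop Prog.isNode (seq p peekLeft)) ((Enc.enc l).word.head?,
          conf [] ((Enc.enc (l, c, b)).word ++ rest) [] [] [])
        (l.length * (q.eval M + 5) + 1)
        (r', conf [] ((Enc.enc (([] : List α), c, l.foldl (step c) b)).word ++ rest)
          [] [] []) := by
    intro c M l
    induction l with
    | nil =>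
      intro b rest _
      exact ⟨_, .mono (.loop_false rfl) (by simp)⟩
    | cons a l ih =>
      intro b rest hM
      obtain ⟨r₂, h₂⟩ := ih (step c b a) rest fun l' hl' => by
        have := hM (a :: l') (by simpa using hl')
        simp only [sz_pair, sz_cons, List.foldl_cons] at this ⊢
        omega
      obtain ⟨r₁, h₁⟩ := hp ((a, l), c, b) rest (some (.bit true))
      have ht : t ((a, l), c, b) ≤ q.eval M := (hq _).trans <| eval_mono q <| by
        have := hM [] (by simp)
        simpa using this
      refine ⟨r₂, .mono (.loop_true rfl (.seq h₁ (exec_peekLeft _ _ _ _)) h₂) ?_⟩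
      simp only [List.length_cons, add_mul]
      omega
  have hwhile : PolyTime fun c => ((l c).foldl (step c) (init c)) := by
    have h1 := hl.pair (id.pair hi)
    obtain ⟨p₁, t₁, ht₁, ht₁', hp₁⟩ := h1
    have h2 : PolyTime fun x : List α × γ × β => x.2.2 := id.snd.snd
    have h3 : PolyTime fun c : γ => (([] : List α), c, (l c).foldl (step c) (init c)) := by
      have hM : PolyBounded fun c => sz (l c) + (sz c + B c + 1) + 1 :=
        (hl.polyBounded.add ((PolyBounded.id.add hB).add (.const 1))).add (.const 1)
      refine ⟨seq p₁ (whileProg p), fun c => t₁ c + (4 + (sz (l c) *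
        (q.eval (sz (l c) + (sz c + B c + 1) + 1) + 5) + 1)), ht₁.add ((PolyBounded.const 4).add
          ((hl.polyBounded.mul ((PolyBounded.eval q hM).add (.const 5))).add (.const 1))),
        hM.mono fun c => ?_, fun c => Runs.seq (hp₁ c) fun rest r => ?_⟩
      · have := h c (l c) (List.prefix_refl _)
        have := one_le_sz (l c)
        simp only [sz_pair, sz_nil]
        omega
      · obtain ⟨r', hr⟩ := hloop c (sz (l c) + (sz c + B c + 1) + 1) (l c) (init c) rest
          fun l' hl' => by
            have := h c l' hl'
            simp only [sz_pair]
            omega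
        refine ⟨r', .mono (.seq (exec_peekLeft _ _ _ _) hr) ?_⟩
        have := Nat.mul_le_mul_right (q.eval (sz (l c) + (sz c + B c + 1) + 1) + 5)
          (length_lt_sz (l c)).le
        omega
    exact h2.comp h3
  exact hwhile

/-- Iteration over a list, where each step enlarges the accumulator by a bounded amount only. -/
theorem foldl {init : γ → β} {l : γ → List α} {step : γ → β → α → β}
    (hi : PolyTime init) (hl : PolyTime l)
    (hs : PolyTime fun x : γ × β × α => step x.1 x.2.1 x.2.2) {G : γ → ℕ} (hG : PolyBounded G)
    (h : ∀ c b, ∀ a ∈ l c, sz (step c b a) ≤ sz b + G c) :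
    PolyTime fun c => (l c).foldl (step c) (init c) := by
  refine foldl_of_bound hi hl hs (B := fun c => sz (init c) + sz (l c) * G c)
    (hi.polyBounded.add (hl.polyBounded.mul hG)) fun c l' hl' => ?_
  have key : ∀ (m : List α) (b : β), (∀ a ∈ m, a ∈ l c) →
      sz (m.foldl (step c) b) ≤ sz b + m.length * G c := by
    intro m
    induction m with
    | nil => simp
    | cons a m ih =>
      intro b hm
      have h1 := ih (step c b a) fun x hx => hm x (List.mem_cons_of_mem _ hx)
      have h2 := h c b a (hm a List.mem_cons_self)
      simp only [List.foldl_cons, List.length_cons, add_mul]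
      omega
  refine (key l' (init c) fun a ha => hl'.subset ha).trans (Nat.add_le_add_left
    (Nat.mul_le_mul_right _ (hl'.length_le.trans (length_lt_sz _).le)) _)

end PolyTime

/-! ### Lists and binary arithmetic in polynomial time -/

/-- The number with the given bits, the least significant bit first. -/
def ofBits (l : List Bool) : ℕ := l.foldr Nat.bit 0

@[simp] theorem ofBits_nil : ofBits [] = 0 := rfl

theorem ofBits_cons (b : Bool) (l : List Bool) : ofBits (b :: l) = 2 * ofBits l + b.toNat :=
  Nat.bit_val _ _

theorem ofBits_bits (n : ℕ) : ofBits n.bits = n := by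
  induction n using Nat.binaryRec' with
  | zero => simp [ofBits]
  | bit b n h ih => rw [Nat.bits_append_bit n b h, ofBits_cons, ih, Nat.bit_val]

theorem sz_bits_le (l : List Bool) : sz l ≤ 4 * l.length + 1 := by
  have := sz_le_of_forall (l := l) (m := 3) fun b _ => sz_bool_le b
  omega

theorem sz_nat_le_of_lt {n k : ℕ} (h : n < 2 ^ k) : sz n ≤ 4 * k + 1 := by
  have h1 := sz_bits_le n.bits
  rw [Nat.size_eq_bits_len] at h1
  have h2 := Nat.size_le.2 h
  rw [sz_nat]
  omega

theorem lt_two_pow_sz (n : ℕ) : n < 2 ^ sz n := by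
  rw [← Nat.size_le, ← Nat.size_eq_bits_len]
  exact (length_lt_sz _).le

theorem sz_bit_le (b : Bool) (n : ℕ) : sz (Nat.bit b n) ≤ sz n + 4 := by
  by_cases h : n = 0 → b = true
  · rw [sz_nat, Nat.bits_append_bit n b h, sz_cons, ← sz_nat]
    have := sz_bool_le b
    omega
  · push Not at h
    obtain ⟨rfl, h⟩ := h
    simp only [ne_eq, Bool.not_eq_true] at h
    subst h
    exact Nat.le_add_right _ _

theorem sz_tail_le {α : Type} [Enc α] (l : List α) : sz l.tail ≤ sz l := by
  cases l <;> simp; omega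

theorem sz_div2_le (n : ℕ) : sz n.div2 ≤ sz n := by
  rw [sz_nat, Nat.div2_bits_eq_tail]
  exact sz_tail_le _

namespace PolyTime

variable {α β γ : Type} [Enc α] [Enc β] [Enc γ]

theorem reverse {f : γ → List α} (hf : PolyTime f) : PolyTime fun c => (f c).reverse := by
  have : PolyTime fun c => (f c).foldl (fun l a => a :: l) [] := by
    refine foldl (const []) hf (id.snd.snd.cons id.snd.fst) (hf.polyBounded.add (.const 1))
      fun c l a ha => ?_
    have := sz_le_of_mem ha
    simp only [sz_cons]
    omega
  simpa [List.foldl_flip_cons_eq_append] using this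

theorem foldr {init : γ → β} {l : γ → List α} {step : γ → α → β → β}
    (hi : PolyTime init) (hl : PolyTime l)
    (hs : PolyTime fun x : γ × β × α => step x.1 x.2.2 x.2.1) {G : γ → ℕ} (hG : PolyBounded G)
    (h : ∀ c b, ∀ a ∈ l c, sz (step c a b) ≤ sz b + G c) :
    PolyTime fun c => (l c).foldr (step c) (init c) := by
  simpa [List.foldl_reverse] using foldl (step := fun c b a => step c a b) hi hl.reverse hs hG
    fun c b a ha => h c b a (List.mem_reverse.1 ha)

theorem append {f g : γ → List α} (hf : PolyTime f) (hg : PolyTime g) :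
    PolyTime fun c => f c ++ g c := by
  have : PolyTime fun c => (f c).foldr (fun a l => a :: l) (g c) := by
    refine foldr hg hf (id.snd.snd.cons id.snd.fst) (hf.polyBounded.add (.const 1))
      fun c l a ha => ?_
    have := sz_le_of_mem ha
    simp only [sz_cons]
    omega
  simpa using this

/-- One step in the comparison of two lists: the second component holds the rest of the second
list, and its head is replaced by a wrong bit if there is none. -/
def eqStep (s : Bool × List Bool) (a : Bool) : Bool × List Bool :=
  (s.1 && !(Bool.xor (s.2.headD (!a)) a), s.2.tail)

theorem foldl_eqStep (l : List Bool) (s : Bool × List Bool) :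
    ((l.foldl eqStep s).1 && (l.foldl eqStep s).2.isEmpty) = (s.1 && decide (l = s.2)) := by
  induction l generalizing s with
  | nil => rcases s with ⟨b, _ | ⟨a, m⟩⟩ <;> simp
  | cons a l ih =>
    rw [List.foldl_cons, ih]
    rcases s with ⟨b, _ | ⟨a', m⟩⟩
    · simp [eqStep]
    · cases a <;> cases a' <;> simp [eqStep]

theorem eq {f g : γ → List Bool} (hf : PolyTime f) (hg : PolyTime g) :
    PolyTime fun c => decide (f c = g c) := by
  have h : PolyTime fun c => (f c).foldl eqStep (true, g c) := by
    refine foldl (step := fun _ => eqStep) ((const true).pair hg) hf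
      ((id.snd.fst.fst.and ((id.snd.fst.snd.headD id.snd.snd.not).xor id.snd.snd).not).pair
        id.snd.fst.snd.tail) (.const 3) fun c s a _ => ?_
    have h1 := sz_bool_le (s.1 && !(Bool.xor (s.2.headD (!a)) a))
    have h2 := sz_tail_le s.2
    obtain ⟨s₁, s₂⟩ := s
    simp only [eqStep, sz_pair] at *
    omega
  have h2 : (fun c => decide (f c = g c)) = fun c =>
      (((f c).foldl eqStep (true, g c)).1 && ((f c).foldl eqStep (true, g c)).2.isEmpty) := by
    funext c
    rw [foldl_eqStep]
    simp
  rw [h2]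
  exact h.fst.and h.snd.isEmpty

theorem bits {f : γ → ℕ} (hf : PolyTime f) : PolyTime fun c => (f c).bits :=
  (of_enc_eq (f := Nat.bits) fun _ => rfl).comp hf

theorem bodd {f : γ → ℕ} (hf : PolyTime f) : PolyTime fun c => (f c).bodd := by
  have : (fun c => (f c).bodd) = fun c => (f c).bits.headD false := by
    funext c
    rw [Nat.bodd_eq_bits_head]
    cases (f c).bits <;> rfl
  rw [this]
  exact hf.bits.headD (const false)

theorem div2 {f : γ → ℕ} (hf : PolyTime f) : PolyTime fun c => (f c).div2 :=
  hf.bits.tail.congr_enc (g := fun c => (f c).div2) (fun c => c) (fun _ => rfl) fun c => by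
    change Enc.enc (f c).div2.bits = _
    rw [Nat.div2_bits_eq_tail]

theorem isZero {f : γ → ℕ} (hf : PolyTime f) : PolyTime fun c => decide (f c = 0) := by
  have : (fun c => decide (f c = 0)) = fun c => (f c).bits.isEmpty := by
    funext c
    rw [Bool.eq_iff_iff, decide_eq_true_iff, List.isEmpty_iff_length_eq_zero,
      Nat.size_eq_bits_len, Nat.size_eq_zero]
  rw [this]
  exact hf.bits.isEmpty

theorem bit {f : γ → Bool} {g : γ → ℕ} (hf : PolyTime f) (hg : PolyTime g) :
    PolyTime fun c => Nat.bit (f c) (g c) := by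
  have h : PolyTime fun c => cond (decide (g c = 0) && !f c) [] (f c :: (g c).bits) :=
    (hg.isZero.and hf.not).cond (const []) (hf.cons hg.bits)
  refine h.congr_enc (g := fun c => Nat.bit (f c) (g c)) (fun c => c) (fun _ => rfl) fun c => ?_
  change Enc.enc (Nat.bit (f c) (g c)).bits = _
  by_cases h : g c = 0 → f c = true
  · rw [Nat.bits_append_bit _ _ h]
    cases hf : f c <;> simp_all
  · push Not at h
    have h2 : f c = false := by simpa using h.2
    simp [h.1, h2]

theorem ofBits {f : γ → List Bool} (hf : PolyTime f) : PolyTime fun c => ofBits (f c) :=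
  foldr (step := fun _ => Nat.bit) (const 0) hf (id.snd.snd.bit id.snd.fst) (.const 4)
    fun _ n b _ => sz_bit_le b n

/-- One step of the addition of two binary numbers. The state consists of the remaining parts of
the two numbers, the carry, and the bits of the sum so far, the most significant one first. -/
def addStep (s : (ℕ × ℕ) × Bool × List Bool) : (ℕ × ℕ) × Bool × List Bool :=
  ((s.1.1.div2, s.1.2.div2),
    (s.1.1.bodd && s.1.2.bodd) || (s.2.1 && Bool.xor s.1.1.bodd s.1.2.bodd),
    Bool.xor (Bool.xor s.1.1.bodd s.1.2.bodd) s.2.1 :: s.2.2)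

theorem foldl_addStep (l : List Bool) (x y : ℕ) (c : Bool) (out : List Bool)
    (h : x + y + c.toNat < 2 ^ l.length) :
    ApproxInclusion.ofBits (l.foldl (fun s _ => addStep s) ((x, y), c, out)).2.2.reverse =
      (x + y + c.toNat) * 2 ^ out.length + ApproxInclusion.ofBits out.reverse := by
  have hcons : ∀ (b : Bool) (out : List Bool), ApproxInclusion.ofBits (b :: out).reverse =
      b.toNat * 2 ^ out.length + ApproxInclusion.ofBits out.reverse := by
    intro b out
    have key : ∀ l : List Bool, ApproxInclusion.ofBits (l ++ [b]) =
        b.toNat * 2 ^ l.length + ApproxInclusion.ofBits l := by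
      intro l
      induction l with
      | nil => cases b <;> simp [ApproxInclusion.ofBits]
      | cons a l ih =>
        rw [List.cons_append, ofBits_cons, ih, ofBits_cons, List.length_cons, pow_succ]
        ring
    rw [List.reverse_cons, key, List.length_reverse]
  induction l generalizing x y c out with
  | nil =>
    have : x + y + c.toNat = 0 := by simpa using h
    simp [this]
  | cons a l ih =>
    have hx := Nat.bodd_add_div2 x
    have hy := Nat.bodd_add_div2 y
    have hs : x + y + c.toNat = 2 * (x.div2 + y.div2 + ((x.bodd && y.bodd) ||
        (c && Bool.xor x.bodd y.bodd)).toNat) + (Bool.xor (Bool.xor x.bodd y.bodd) c).toNat := by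
      generalize x.bodd = a at *
      generalize y.bodd = b at *
      cases a <;> cases b <;> cases c <;> simp at hx hy ⊢ <;> omega
    rw [List.foldl_cons]
    simp only [addStep] at ih ⊢
    rw [ih, hcons, hs, List.length_cons, pow_succ]
    · ring
    · rw [List.length_cons, pow_succ] at h
      omega

theorem add {f g : γ → ℕ} (hf : PolyTime f) (hg : PolyTime g) :
    PolyTime fun c => f c + g c := by
  have h : PolyTime fun c => ((f c).bits ++ true :: (g c).bits).foldl (fun s _ => addStep s)
      ((f c, g c), false, []) := by
    refine foldl (step := fun _ s _ => addStep s)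
      ((hf.pair hg).pair ((const false).pair (const [])))
      (hf.bits.append ((const true).cons hg.bits))
      ?_ (.const 7) fun _ s _ _ => ?_
    · have hs : PolyTime fun x : γ × ((ℕ × ℕ) × Bool × List Bool) × Bool => x.2.1 := id.snd.fst
      exact ((hs.fst.fst.div2).pair hs.fst.snd.div2).pair
        (((hs.fst.fst.bodd.and hs.fst.snd.bodd).or
          (hs.snd.fst.and (hs.fst.fst.bodd.xor hs.fst.snd.bodd))).pair
        (((hs.fst.fst.bodd.xor hs.fst.snd.bodd).xor hs.snd.fst).cons hs.snd.snd))
    · obtain ⟨⟨x, y⟩, c, out⟩ := s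
      have h1 := sz_div2_le x
      have h2 := sz_div2_le y
      have h3 := sz_bool_le ((x.bodd && y.bodd) || (c && Bool.xor x.bodd y.bodd))
      have h4 := sz_bool_le (Bool.xor (Bool.xor x.bodd y.bodd) c)
      simp only [addStep, sz_pair, sz_cons]
      have := one_le_sz c
      omega
  have h2 : (fun c => f c + g c) = fun c => ApproxInclusion.ofBits
      (((f c).bits ++ true :: (g c).bits).foldl (fun s _ => addStep s)
        ((f c, g c), false, [])).2.2.reverse := by
    funext c
    rw [foldl_addStep]
    · simp [ApproxInclusion.ofBits]
    · have h1 : f c < 2 ^ (f c).size := Nat.lt_size_self _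
      have h2 : g c < 2 ^ (g c).size := Nat.lt_size_self _
      have h3 : 2 ^ (f c).size ≤ 2 ^ ((f c).size + (g c).size) :=
        Nat.pow_le_pow_right (by norm_num) (by omega)
      have h4 : 2 ^ (g c).size ≤ 2 ^ ((f c).size + (g c).size) :=
        Nat.pow_le_pow_right (by norm_num) (by omega)
      simp only [List.length_append, List.length_cons, Nat.size_eq_bits_len, Bool.toNat_false,
        ← add_assoc, pow_succ]
      omega
  rw [h2]
  exact h.snd.snd.reverse.ofBits

theorem mul {f g : γ → ℕ} (hf : PolyTime f) (hg : PolyTime g) :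
    PolyTime fun c => f c * g c := by
  have hval : ∀ (y : ℕ) (l : List Bool),
      l.foldr (fun b n => Nat.bit false n + cond b y 0) 0 = ApproxInclusion.ofBits l * y := by
    intro y l
    induction l with
    | nil => simp [ApproxInclusion.ofBits]
    | cons b l ih =>
      rw [List.foldr_cons, ih, ofBits_cons, Nat.bit_val]
      cases b
      · simp [mul_assoc]
      · simp only [Bool.toNat_false, Bool.toNat_true, cond_true]
        ring
  have hlt : ∀ (y : ℕ) (l : List Bool) (m k : ℕ), m < 2 ^ k → ∃ m' < 2 ^ (k + l.length),
      l.foldl (fun n b => Nat.bit false n + cond b y 0) (m * y) = m' * y := by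
    intro y l
    induction l with
    | nil => exact fun m k h => ⟨m, h, rfl⟩
    | cons b l ih =>
      intro m k h
      obtain ⟨m', h1, h2⟩ := ih (2 * m + b.toNat) (k + 1) (by
        have := b.toNat_lt
        rw [pow_succ]
        omega)
      refine ⟨m', by rwa [List.length_cons, add_comm l.length, ← add_assoc], ?_⟩
      rw [← h2, List.foldl_cons, Nat.bit_val]
      congr 1
      cases b
      · simp [mul_assoc]
      · simp only [Bool.toNat_false, Bool.toNat_true, cond_true]
        ring
  have h : PolyTime fun c => (f c).bits.reverse.foldl
      (fun n b => Nat.bit false n + cond b (g c) 0) 0 := by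
    refine foldl_of_bound (step := fun c n b => Nat.bit false n + cond b (g c) 0) (const 0)
      hf.bits.reverse
      (((const false).bit id.snd.fst).add (id.snd.snd.cond (hg.comp id.fst) (const 0)))
      (B := fun c => 4 * (sz (f c) + sz (g c)) + 1)
      (((PolyBounded.const 4).mul (hf.polyBounded.add hg.polyBounded)).add (.const 1))
      fun c l' hl' => sz_nat_le_of_lt ?_
    obtain ⟨m', h1, h2⟩ := hlt (g c) l' 0 0 (by norm_num)
    rw [zero_mul] at h2
    rw [h2, pow_add]
    have h3 : l'.length ≤ sz (f c) := by
      have := hl'.length_le.trans (List.length_reverse ▸ (length_lt_sz (f c).bits).le)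
      exact this
    exact Nat.mul_lt_mul_of_lt_of_lt
      (h1.trans_le (Nat.pow_le_pow_right (by norm_num) (by omega))) (lt_two_pow_sz _)
  refine h.congr_enc (g := fun c => f c * g c) (fun c => c) (fun _ => rfl) fun c => ?_
  rw [List.foldl_reverse, hval, ofBits_bits]

/-- One step of the comparison of two binary numbers: the remaining part of the second number, and
whether the first number is not larger as far as the bits are known. -/
def leStep (s : ℕ × Bool) (a : Bool) : ℕ × Bool :=
  (s.1.div2, cond (Bool.xor a s.1.bodd) (!a) s.2)

theorem foldl_leStep (l : List Bool) (y : ℕ) (b : Bool) :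
    (!decide ((l.foldl leStep (y, b)).1 = 0) || (l.foldl leStep (y, b)).2) =
      decide (ApproxInclusion.ofBits l < y ∨ ApproxInclusion.ofBits l = y ∧ b = true) := by
  induction l generalizing y b with
  | nil =>
    rcases Nat.eq_zero_or_pos y with rfl | h
    · cases b <;> simp
    · cases b <;> simp [h, h.ne']
  | cons a l ih =>
    rw [List.foldl_cons, leStep, ih, ofBits_cons]
    have hy := Nat.bodd_add_div2 y
    rw [decide_eq_decide]
    generalize ApproxInclusion.ofBits l = x at *
    simp only at hy ⊢
    generalize y.bodd = e at *
    generalize y.div2 = d at *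
    subst hy
    cases a <;> cases e <;> cases b <;> simp <;> omega

theorem le {f g : γ → ℕ} (hf : PolyTime f) (hg : PolyTime g) :
    PolyTime fun c => decide (f c ≤ g c) := by
  have h : PolyTime fun c => (f c).bits.foldl leStep (g c, true) := by
    refine foldl (step := fun _ => leStep) (hg.pair (const true)) hf.bits
      (id.snd.fst.fst.div2.pair ((id.snd.snd.xor id.snd.fst.fst.bodd).cond id.snd.snd.not
        id.snd.fst.snd)) (.const 3) fun c s a _ => ?_
    obtain ⟨y, b⟩ := s
    have h1 := sz_div2_le y
    have h2 := sz_bool_le (cond (Bool.xor a y.bodd) (!a) b)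
    simp only [leStep, sz_pair]
    omega
  have h2 : (fun c => decide (f c ≤ g c)) = fun c =>
      (!decide (((f c).bits.foldl leStep (g c, true)).1 = 0) ||
        ((f c).bits.foldl leStep (g c, true)).2) := by
    funext c
    rw [foldl_leStep, ofBits_bits, decide_eq_decide]
    simp
    omega
  rw [h2]
  exact h.fst.isZero.not.or h.snd

end PolyTime

/-! ### Parsing -/

open Computability

/-- A symbol is encoded by four truth values: whether it is a bit, the value of the bit, whether it
is a closing bracket, and whether it is an opening bracket. The blank, which does not occur in the
words that are parsed, is not told apart from the comma. -/
def symbolBits : Γ' → Bool × Bool × Bool × Bool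
  | .bit b => (true, b, false, false)
  | .ket => (false, false, true, false)
  | .bra => (false, false, false, true)
  | _ => (false, false, false, false)

instance : Enc Γ' := ⟨fun x => Enc.enc (symbolBits x)⟩

/-- One step of the parser, which reads a word from right to left. The state consists of the fields
of the current atom and the atoms that are complete, each of them a list of fields. -/
def parseStep (x : Γ') (s : List (List Bool) × List (List (List Bool))) :
    List (List Bool) × List (List (List Bool)) :=
  match x with
  | .ket => ([[]], s.2)
  | .bit b => ((b :: s.1.headD []) :: s.1.tail, s.2)
  | .bra => ([], s.1 :: s.2)
  | _ => ([] :: s.1, s.2)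

/-- The atoms of a word, each of them given as the list of its fields. -/
def parse (w : List Γ') : List (List (List Bool)) := (w.foldr parseStep ([], [])).2

theorem sz_parseStep_le (x : Γ') (s : List (List Bool) × List (List (List Bool))) :
    sz (parseStep x s) ≤ sz s + 7 := by
  obtain ⟨s₁, s₂⟩ := s
  cases x with
  | bit b =>
    have := sz_bool_le b
    cases s₁ <;> simp [parseStep] <;> omega
  | ket =>
    have := one_le_sz s₁
    simp [parseStep]
    omega
  | _ => simp [parseStep]; omega

theorem polyTime_parse {γ : Type} [Enc γ] {f : γ → List Γ'} (hf : PolyTime f) :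
    PolyTime fun c => parse (f c) := by
  refine (PolyTime.foldr (step := fun _ => parseStep) (PolyTime.const ([], [])) hf ?_ (.const 7)
    fun _ s x _ => sz_parseStep_le x s).snd
  -- the tests on the symbol are projections of its encoding
  have hb : PolyTime symbolBits := PolyTime.of_enc_eq fun _ => rfl
  have hx := hb.comp
    (PolyTime.id (α := γ × (List (List Bool) × List (List (List Bool))) × Γ')).snd.snd
  have hs := (PolyTime.id (α := γ × (List (List Bool) × List (List (List Bool))) × Γ')).snd.fst
  have : (fun x : γ × (List (List Bool) × List (List (List Bool))) × Γ' =>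
      parseStep x.2.2 x.2.1) = fun x =>
      cond (symbolBits x.2.2).2.2.1 ([[]], x.2.1.2) (cond (symbolBits x.2.2).1
        (((symbolBits x.2.2).2.1 :: x.2.1.1.headD []) :: x.2.1.1.tail, x.2.1.2)
        (cond (symbolBits x.2.2).2.2.2 ([], x.2.1.1 :: x.2.1.2) ([] :: x.2.1.1, x.2.1.2))) := by
    funext ⟨_, s, x⟩
    cases x <;> rfl
  rw [this]
  exact hx.snd.snd.fst.cond ((PolyTime.const _).pair hs.snd) (hx.fst.cond
    (((hx.snd.fst.cons (hs.fst.headD (.const []))).cons hs.fst.tail).pair hs.snd)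
    (hx.snd.snd.snd.cond ((PolyTime.const []).pair (hs.fst.cons hs.snd))
      (((PolyTime.const []).cons hs.fst).pair hs.snd)))

theorem foldr_parseStep_bits (l f : List Bool) (fs : List (List Bool))
    (done : List (List (List Bool))) :
    (bits l).foldr parseStep (f :: fs, done) = ((l ++ f) :: fs, done) := by
  induction l with
  | nil => rfl
  | cons b l ih =>
    change parseStep (.bit b) ((bits l).foldr parseStep (f :: fs, done)) = _
    rw [ih]
    rfl

/-- The word for several fields, separated by commas. -/
def fieldsWord : List (List Bool) → List Γ'
  | [] => []
  | [f] => bits f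
  | f :: g :: fs => bits f ++ Γ'.comma :: fieldsWord (g :: fs)

theorem foldr_parseStep_fieldsWord (f : List Bool) (fs : List (List Bool))
    (done : List (List (List Bool))) :
    (fieldsWord (f :: fs)).foldr parseStep ([[]], done) = (f :: fs, done) := by
  induction fs generalizing f with
  | nil => simpa [fieldsWord] using foldr_parseStep_bits f [] [] done
  | cons g fs ih =>
    rw [fieldsWord, List.foldr_append, List.foldr_cons, ih]
    change (bits f).foldr parseStep ([] :: g :: fs, done) = _
    simpa using foldr_parseStep_bits f [] (g :: fs) done

theorem parse_inputWord {V α : Type} {name : V → List Bool} {w : α → List Γ'}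
    {flds : α → List (List Bool)} (h0 : ∀ p, flds p ≠ []) (hw : ∀ p, w p = fieldsWord (flds p))
    (i : Input V α) :
    parse (inputWord name w i) =
      (i.goal :: i.assumptions).map fun a => name a.lhs :: name a.rhs :: flds a.approx := by
  have hatom : ∀ (a : Atom V α) (s : List (List Bool) × List (List (List Bool))),
      (atomWord name w a).foldr parseStep s =
        ([], (name a.lhs :: name a.rhs :: flds a.approx) :: s.2) := by
    intro a s
    obtain ⟨f, fs, hf⟩ := List.exists_cons_of_ne_nil (h0 a.approx)
    have : atomWord name w a = Γ'.bra :: (fieldsWord (name a.lhs :: name a.rhs :: f :: fs) ++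
        [Γ'.ket]) := by
      simp [atomWord, hw, hf, fieldsWord]
    rw [this, List.foldr_cons, List.foldr_append]
    change parseStep _ (List.foldr parseStep ([[]], s.2) _) = _
    rw [foldr_parseStep_fieldsWord, hf]
    rfl
  have hlist : ∀ l : List (Atom V α), (l.flatMap (atomWord name w)).foldr parseStep ([], []) =
      ([], l.map fun a => name a.lhs :: name a.rhs :: flds a.approx) := by
    intro l
    induction l with
    | nil => rfl
    | cons a l ih => rw [List.flatMap_cons, List.foldr_append, ih, hatom, List.map_cons]
  have : inputWord name w i = (i.goal :: i.assumptions).flatMap (atomWord name w) := rfl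
  rw [parse, this, hlist]

theorem encodeNat_eq_bits (n : ℕ) : encodeNat n = n.bits := by
  have hpos : ∀ p : PosNum, encodePosNum p = Nat.bits (p : ℕ) := by
    intro p
    induction p with
    | one => simp [encodePosNum]
    | bit0 p ih =>
      have h := Nat.bits_append_bit (p : ℕ) false fun h => absurd h (PosNum.to_nat_pos p).ne'
      rw [encodePosNum, ih, ← h]
      congr 1
      simp [Nat.bit_val]
      omega
    | bit1 p ih =>
      have h := Nat.bits_append_bit (p : ℕ) true fun h => rfl
      rw [encodePosNum, ih, ← h]
      congr 1
      simp [Nat.bit_val]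
      omega
  have hnum : ∀ m : Num, encodeNum m = Nat.bits (m : ℕ) := by
    rintro (_ | p)
    · simp [encodeNum]
    · exact hpos p
  rw [encodeNat, hnum, Num.to_of_nat]

/-! ### The shortest path algorithm -/

/-- The left-hand side of an atom that is given by its fields. -/
def fieldLhs (e : List (List Bool)) : List Bool := e.headD []

/-- The right-hand side of an atom that is given by its fields. -/
def fieldRhs (e : List (List Bool)) : List Bool := e.tail.headD []

/-- The numerator of the approximation of an atom. -/
def fieldNum (e : List (List Bool)) : ℕ := ofBits (e.tail.tail.headD [])

/-- The denominator of the approximation of an atom. It is `1` if there is no field for it, as for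
quantity approximate atoms. -/
def fieldDen (e : List (List Bool)) : ℕ := ofBits (e.tail.tail.tail.headD [true])

/-- The smaller one of two fractions, which are given by their numerators and denominators. The
fraction `1 / 0` stands for infinity. -/
def minFrac (p q : ℕ × ℕ) : ℕ × ℕ := if p.1 * q.2 ≤ q.1 * p.2 then p else q

/-- A table lists upper bounds for the distances of vertices to a fixed vertex, as fractions. This
is the smallest bound for `v`. -/
def lookup (v : List Bool) (t : List (List Bool × ℕ × ℕ)) : ℕ × ℕ :=
  t.foldl (fun q e => if e.1 = v then minFrac q e.2 else q) (1, 0)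

/-- Adds the bound for the left-hand side of an atom that follows from the best bound for its
right-hand side. -/
def relax (t : List (List Bool × ℕ × ℕ)) (e : List (List Bool)) : List (List Bool × ℕ × ℕ) :=
  (fieldLhs e, (lookup (fieldRhs e) t).1 * fieldDen e + fieldNum e * (lookup (fieldRhs e) t).2,
    (lookup (fieldRhs e) t).2 * fieldDen e) :: t

/-- A list, repeated as often as it has elements. -/
def rounds {α : Type} (l : List α) : List α := l.foldl (fun m _ => l ++ m) []

/-- The bounds for the distances to `y` that the algorithm of Bellman and Ford finds. -/
def distances (y : List Bool) (es : List (List (List Bool))) : List (List Bool × ℕ × ℕ) :=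
  (rounds es).foldl relax [(y, 0, 1)]

/-- Whether the first atom has at least the approximation that the others give along a shortest
path. For `ratio = true`, it also suffices that its approximation is at least `1`. -/
def check (ratio : Bool) (atoms : List (List (List Bool))) : Bool :=
  (ratio && decide (fieldDen (atoms.headD []) ≤ fieldNum (atoms.headD []))) ||
    decide ((lookup (fieldLhs (atoms.headD []))
        (distances (fieldRhs (atoms.headD [])) atoms.tail)).1 *
        fieldDen (atoms.headD []) ≤
      fieldNum (atoms.headD []) *
        (lookup (fieldLhs (atoms.headD [])) (distances (fieldRhs (atoms.headD [])) atoms.tail)).2)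

theorem mem_of_mem_rounds {α : Type} {l : List α} {a : α} (h : a ∈ rounds l) : a ∈ l := by
  have key : ∀ k m : List α, (∀ a ∈ m, a ∈ l) → ∀ a ∈ k.foldl (fun m _ => l ++ m) m, a ∈ l := by
    intro k
    induction k with
    | nil => exact fun m h => h
    | cons b k ih =>
      intro m hm
      refine ih _ fun a ha => ?_
      rcases List.mem_append.1 ha with ha | ha
      exacts [ha, hm a ha]
  exact key l [] (by simp) a h

theorem lookup_mem (v : List Bool) (t : List (List Bool × ℕ × ℕ)) :
    lookup v t = (1, 0) ∨ (v, lookup v t) ∈ t := by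
  have key : ∀ (t : List (List Bool × ℕ × ℕ)) (q : ℕ × ℕ),
      t.foldl (fun q e => if e.1 = v then minFrac q e.2 else q) q = q ∨
        (v, t.foldl (fun q e => if e.1 = v then minFrac q e.2 else q) q) ∈ t := by
    intro t
    induction t with
    | nil => exact fun q => .inl rfl
    | cons e t ih =>
      intro q
      rw [List.foldl_cons]
      rcases ih (if e.1 = v then minFrac q e.2 else q) with h | h
      · rw [h]
        by_cases hv : e.1 = v
        · subst hv
          rw [if_pos rfl, minFrac]
          split_ifs
          · exact .inl rfl
          · exact .inr List.mem_cons_self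
        · exact .inl (if_neg hv)
      · exact .inr (List.mem_cons_of_mem _ h)
  exact key t (1, 0)

/-! ### Its running time -/

theorem ofBits_lt (l : List Bool) : ofBits l < 2 ^ l.length := by
  induction l with
  | nil => simp
  | cons b l ih =>
    have := b.toNat_lt
    rw [ofBits_cons, List.length_cons, pow_succ]
    omega

namespace PolyTime

variable {γ : Type} [Enc γ]

theorem fieldLhs {f : γ → List (List Bool)} (hf : PolyTime f) :
    PolyTime fun c => fieldLhs (f c) := hf.headD (const [])

theorem fieldRhs {f : γ → List (List Bool)} (hf : PolyTime f) :
    PolyTime fun c => fieldRhs (f c) := hf.tail.headD (const [])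

theorem fieldNum {f : γ → List (List Bool)} (hf : PolyTime f) :
    PolyTime fun c => fieldNum (f c) := (hf.tail.tail.headD (const [])).ofBits

theorem fieldDen {f : γ → List (List Bool)} (hf : PolyTime f) :
    PolyTime fun c => fieldDen (f c) := (hf.tail.tail.tail.headD (const [true])).ofBits

theorem minFrac {f g : γ → ℕ × ℕ} (hf : PolyTime f) (hg : PolyTime g) :
    PolyTime fun c => minFrac (f c) (g c) :=
  PolyTime.ite ((hf.fst.mul hg.snd).le (hg.fst.mul hf.snd)) hf hg

theorem lookup {f : γ → List Bool} {t : γ → List (List Bool × ℕ × ℕ)} (hf : PolyTime f)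
    (ht : PolyTime t) : PolyTime fun c => lookup (f c) (t c) := by
  have hx : PolyTime fun x : γ × (ℕ × ℕ) × (List Bool × ℕ × ℕ) => x := id
  have hs : PolyTime fun x : γ × (ℕ × ℕ) × (List Bool × ℕ × ℕ) =>
      if x.2.2.1 = f x.1 then ApproxInclusion.minFrac x.2.1 x.2.2.2 else x.2.1 :=
    PolyTime.ite (hx.snd.snd.fst.eq (hf.comp hx.fst)) (hx.snd.fst.minFrac hx.snd.snd.snd) hx.snd.fst
  have h : ∀ (c : γ) (q : ℕ × ℕ) (e : List Bool × ℕ × ℕ), e ∈ t c →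
      sz (if e.1 = f c then ApproxInclusion.minFrac q e.2 else q) ≤ sz q + sz (t c) := by
    intro c q e he
    have h1 := sz_le_of_mem he
    have h2 : sz e.2 ≤ sz e := by have := sz_pair e.1 e.2; simp only [Prod.mk.eta] at this; omega
    rw [ApproxInclusion.minFrac]
    split_ifs <;> omega
  exact foldl (init := fun _ : γ => ((1, 0) : ℕ × ℕ)) (l := t)
    (step := fun c q e => if e.1 = f c then ApproxInclusion.minFrac q e.2 else q)
    (G := fun c => sz (t c)) (const _) ht hs ht.polyBounded h

theorem relax {t : γ → List (List Bool × ℕ × ℕ)} {e : γ → List (List Bool)} (ht : PolyTime t)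
    (he : PolyTime e) : PolyTime fun c => relax (t c) (e c) :=
  have hl := he.fieldRhs.lookup ht
  (he.fieldLhs.pair (((hl.fst.mul he.fieldDen).add (he.fieldNum.mul hl.snd)).pair
    (hl.snd.mul he.fieldDen))).cons ht

theorem rounds {α : Type} [Enc α] {f : γ → List α} (hf : PolyTime f) :
    PolyTime fun c => rounds (f c) := by
  have hsz : ∀ l m : List α, sz (l ++ m) ≤ sz m + sz l := by
    intro l m
    induction l with
    | nil => simp
    | cons a l ih => simp only [List.cons_append, sz_cons]; omega
  exact foldl (step := fun c m _ => f c ++ m) (const []) hf ((hf.comp id.fst).append id.snd.fst)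
    hf.polyBounded fun c m _ _ => hsz (f c) m

theorem distances {y : γ → List Bool} {es : γ → List (List (List Bool))} (hy : PolyTime y)
    (hes : PolyTime es) : PolyTime fun c => distances (y c) (es c) := by
  -- the numbers in an atom have fewer bits than the input has symbols
  have hfield : ∀ (e : List (List Bool)) (es : List (List (List Bool))), e ∈ es →
      sz (ApproxInclusion.fieldLhs e) ≤ sz es ∧ ApproxInclusion.fieldNum e < 2 ^ sz es ∧
        ApproxInclusion.fieldDen e < 2 ^ sz es := by
    intro e es he
    have h1 := sz_le_of_mem he
    have hhead : ∀ (l : List (List Bool)) (d : List Bool), sz d ≤ sz es → sz l ≤ sz es →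
        sz (l.headD d) ≤ sz es := by
      rintro (_ | ⟨f, l⟩) d h2 h3
      · exact h2
      · simp only [sz_cons, List.headD_cons] at h3 ⊢
        omega
    have hlt : ∀ l : List Bool, sz l ≤ sz es → ApproxInclusion.ofBits l < 2 ^ sz es := fun l hl =>
      (ofBits_lt l).trans_le (Nat.pow_le_pow_right (by norm_num) ((length_lt_sz l).le.trans hl))
    have h2 := sz_tail_le e
    have h3 := sz_tail_le e.tail
    have h4 := sz_tail_le e.tail.tail
    have h5 := one_le_sz es
    refine ⟨hhead _ _ h5 h1, hlt _ (hhead _ _ h5 (by omega)), ?_⟩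
    rcases h : e.tail.tail.tail with _ | ⟨f, l⟩
    · rw [ApproxInclusion.fieldDen, h]
      exact Nat.one_lt_two_pow (by omega)
    · refine hlt _ ?_
      have := hhead e.tail.tail.tail f (by rw [h, sz_cons] at h4; omega) (by omega)
      rw [h] at this ⊢
      exact this
  -- every entry that is added has a bounded number of bits more than the previous ones
  have hinv : ∀ (y : List Bool) (es l : List (List (List Bool))), (∀ e ∈ l, e ∈ es) →
      ∀ (t : List (List Bool × ℕ × ℕ)) (k : ℕ), 0 < k → (∀ e ∈ t, sz e.1 ≤ sz es + sz y ∧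
        e.2.1 < 2 ^ k ∧ e.2.2 < 2 ^ k) →
      (l.foldl ApproxInclusion.relax t).length = t.length + l.length ∧
      ∀ e ∈ l.foldl ApproxInclusion.relax t, sz e.1 ≤ sz es + sz y ∧
        e.2.1 < 2 ^ (k + l.length * (sz es + 1)) ∧ e.2.2 < 2 ^ (k + l.length * (sz es + 1)) := by
    intro y es l
    induction l with
    | nil => intro _ t k _ ht; simpa using ht
    | cons e l ih =>
      intro hl t k hk ht
      obtain ⟨h1, h2⟩ := ih (fun e he => hl e (List.mem_cons_of_mem _ he))
        (ApproxInclusion.relax t e) (k + (sz es + 1)) (by omega) (by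
          intro e' he'
          rcases List.mem_cons.1 he' with rfl | he'
          · obtain ⟨h1, h2, h3⟩ := hfield e es (hl e List.mem_cons_self)
            obtain ⟨h4, h5⟩ : (ApproxInclusion.lookup (ApproxInclusion.fieldRhs e) t).1 < 2 ^ k ∧
                (ApproxInclusion.lookup (ApproxInclusion.fieldRhs e) t).2 < 2 ^ k := by
              rcases lookup_mem (ApproxInclusion.fieldRhs e) t with h | h
              · rw [h]
                exact ⟨Nat.one_lt_two_pow hk.ne', by positivity⟩
              · exact (ht _ h).2
            have h6 := Nat.mul_lt_mul_of_lt_of_lt h4 h3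
            have h7 := Nat.mul_lt_mul_of_lt_of_lt h2 h5
            have h8 := Nat.mul_lt_mul_of_lt_of_lt h5 h3
            have h9 : 2 ^ (k + (sz es + 1)) = 2 * (2 ^ k * 2 ^ sz es) := by ring
            rw [mul_comm (2 ^ sz es)] at h7
            refine ⟨by dsimp only; omega, ?_, ?_⟩
            · rw [h9]; dsimp only; omega
            · rw [h9]; dsimp only; omega
          · obtain ⟨h1, h2, h3⟩ := ht e' he'
            have := Nat.pow_le_pow_right (n := 2) (by norm_num)
              (show k ≤ k + (sz es + 1) by omega)
            exact ⟨h1, by omega, by omega⟩)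
      refine ⟨by rw [List.foldl_cons, h1]; simp [ApproxInclusion.relax]; omega, fun e' he' => ?_⟩
      have h3 := h2 e' he'
      rwa [show k + (sz es + 1) + l.length * (sz es + 1) =
        k + (e :: l).length * (sz es + 1) by rw [List.length_cons]; ring] at h3
  have hr := hes.rounds.polyBounded
  have hB : PolyBounded fun c => (1 + sz (ApproxInclusion.rounds (es c))) *
      ((sz (es c) + sz (y c)) + (8 * (1 + sz (ApproxInclusion.rounds (es c)) * (sz (es c) + 1))
        + 4) + 1) + 1 :=
    (((PolyBounded.const 1).add hr).mul (((hes.polyBounded.add hy.polyBounded).add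
      (((PolyBounded.const 8).mul ((PolyBounded.const 1).add (hr.mul (hes.polyBounded.add
        (.const 1))))).add (.const 4))).add (.const 1))).add (.const 1)
  refine foldl_of_bound (step := fun _ => ApproxInclusion.relax)
    ((hy.pair ((const 0).pair (const 1))).cons (const [])) hes.rounds
    (id.snd.fst.relax id.snd.snd) hB fun c l' hl' => ?_
  obtain ⟨h1, h2⟩ := hinv (y c) (es c) l' (fun e he => mem_of_mem_rounds (hl'.subset he))
    [(y c, 0, 1)] 1 one_pos (by simp)
  have hlen : l'.length ≤ sz (ApproxInclusion.rounds (es c)) :=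
    hl'.length_le.trans (length_lt_sz _).le
  have hmul := Nat.mul_le_mul_right (sz (es c) + 1) hlen
  have := sz_le_of_forall (l := l'.foldl ApproxInclusion.relax [(y c, 0, 1)])
    (m := (sz (es c) + sz (y c)) + (8 * (1 + sz (ApproxInclusion.rounds (es c)) *
      (sz (es c) + 1)) + 4)) (fun e he => by
        obtain ⟨h3, h4, h5⟩ := h2 e he
        have h6 := sz_nat_le_of_lt h4
        have h7 := sz_nat_le_of_lt h5
        obtain ⟨u, a, b⟩ := e
        simp only [sz_pair] at *
        omega)
  rw [h1] at this
  refine this.trans (Nat.add_le_add_right (Nat.mul_le_mul_right _ ?_) _)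
  simpa using hlen

theorem check (ratio : Bool) {f : γ → List (List (List Bool))} (hf : PolyTime f) :
    PolyTime fun c => check ratio (f c) := by
  have hg : PolyTime fun c => (f c).headD [] := hf.headD (const [])
  have hd := hg.fieldLhs.lookup (hg.fieldRhs.distances hf.tail)
  exact ((const ratio).and (hg.fieldDen.le hg.fieldNum)).or
    ((hd.fst.mul hg.fieldDen).le (hg.fieldNum.mul hd.snd))

end PolyTime

/-! ### Walks and the correctness of the shortest path algorithm -/

/-- `Walk w S y l u W`: the atoms in `S` form a walk from `u` to `y` of total weight `W`, where an
atom `a` is an edge from `a.lhs` to `a.rhs` of weight `w a.approx`. The vertices that the edges of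
the walk start from are listed in `l`. -/
inductive Walk {V α : Type} (w : α → ℚ) (S : Set (Atom V α)) (y : V) : List V → V → ℚ → Prop
  | refl : Walk w S y [] y 0
  | step {a l W} : a ∈ S → Walk w S y l a.rhs W →
      Walk w S y (a.lhs :: l) a.lhs (w a.approx + W)

namespace Walk

variable {V α : Type} {w : α → ℚ} {S : Set (Atom V α)} {y : V}

theorem exists_suffix (hw : ∀ p, 0 ≤ w p) {l : List V} {u : V} {W : ℚ} (h : Walk w S y l u W)
    {v : V} (hv : v ∈ l) : ∃ l' W', Walk w S y l' v W' ∧ W' ≤ W ∧ l' <:+ l := by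
  induction h with
  | refl => simp at hv
  | @step a l W ha h ih =>
    rcases List.mem_cons.1 hv with rfl | hv
    · exact ⟨_, _, .step ha h, le_rfl, List.suffix_refl _⟩
    · obtain ⟨l', W', h1, h2, h3⟩ := ih hv
      exact ⟨l', W', h1, h2.trans (le_add_of_nonneg_left (hw _)), h3.trans (List.suffix_cons _ _)⟩

/-- A walk can be shortened such that no two edges start from the same vertex. -/
theorem exists_nodup (hw : ∀ p, 0 ≤ w p) {l : List V} {u : V} {W : ℚ} (h : Walk w S y l u W) :
    ∃ l' W', Walk w S y l' u W' ∧ W' ≤ W ∧ l'.Nodup := by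
  induction h with
  | refl => exact ⟨[], 0, .refl, le_rfl, List.nodup_nil⟩
  | @step a l W ha h ih =>
    obtain ⟨l', W', h1, h2, h3⟩ := ih
    by_cases hl : a.lhs ∈ l'
    · obtain ⟨l'', W'', h4, h5, h6⟩ := h1.exists_suffix hw hl
      exact ⟨l'', W'', h4, h5.trans (h2.trans (le_add_of_nonneg_left (hw _))),
        h3.sublist h6.sublist⟩
    · exact ⟨_, _, .step ha h1, by gcongr, List.nodup_cons.2 ⟨hl, h3⟩⟩

theorem subset {l : List V} {u : V} {W : ℚ} (h : Walk w S y l u W) :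
    ∀ v ∈ l, ∃ a ∈ S, a.lhs = v := by
  induction h with
  | refl => simp
  | @step a l W ha h ih =>
    intro v hv
    rcases List.mem_cons.1 hv with rfl | hv
    exacts [⟨a, ha, rfl⟩, ih v hv]

end Walk

/-- The pairs that stand for a fraction or for infinity. -/
def ValidFrac (p : ℕ × ℕ) : Prop := 0 < p.1 ∨ 0 < p.2

/-- The fraction `p` is at most `W`. -/
def FracLE (p : ℕ × ℕ) (W : ℚ) : Prop := (p.1 : ℚ) ≤ W * p.2

theorem FracLE.pos {p : ℕ × ℕ} {W : ℚ} (h : FracLE p W) (hp : ValidFrac p) : 0 < p.2 := by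
  by_contra h0
  have h1 : p.2 = 0 := by omega
  rw [FracLE, h1] at h
  have h2 : (p.1 : ℚ) ≤ 0 := by simpa using h
  rcases hp with hp | hp
  · have : (0 : ℚ) < p.1 := by exact_mod_cast hp
    linarith
  · omega

theorem ValidFrac.minFrac {p q : ℕ × ℕ} (hp : ValidFrac p) (hq : ValidFrac q) :
    ValidFrac (minFrac p q) := by
  rw [ApproxInclusion.minFrac]
  split_ifs
  exacts [hp, hq]

theorem FracLE.minFrac_left {p q : ℕ × ℕ} {W : ℚ} (h : FracLE p W) (hp : ValidFrac p) :
    FracLE (minFrac p q) W := by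
  rw [minFrac]
  split_ifs with hle
  · exact h
  · have h1 : (0 : ℚ) < p.2 := by exact_mod_cast h.pos hp
    have h2 : (q.1 : ℚ) * p.2 < p.1 * q.2 := by exact_mod_cast not_le.1 hle
    have h3 : (p.1 : ℚ) * q.2 ≤ W * p.2 * q.2 := by gcongr; exact h
    rw [FracLE]
    nlinarith

theorem FracLE.minFrac_right {p q : ℕ × ℕ} {W : ℚ} (h : FracLE q W) (hq : ValidFrac q) :
    FracLE (minFrac p q) W := by
  rw [minFrac]
  split_ifs with hle
  · have h1 : (0 : ℚ) < q.2 := by exact_mod_cast h.pos hq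
    have h2 : (p.1 : ℚ) * q.2 ≤ q.1 * p.2 := by exact_mod_cast hle
    have h3 : (q.1 : ℚ) * p.2 ≤ W * q.2 * p.2 := by gcongr; exact h
    rw [FracLE]
    nlinarith
  · exact h

theorem lookup_spec {v : List Bool} {t : List (List Bool × ℕ × ℕ)}
    (ht : ∀ e ∈ t, ValidFrac e.2) :
    ValidFrac (lookup v t) ∧ ∀ W, ∀ e ∈ t, e.1 = v → FracLE e.2 W → FracLE (lookup v t) W := by
  have key : ∀ (t : List (List Bool × ℕ × ℕ)) (q : ℕ × ℕ), (∀ e ∈ t, ValidFrac e.2) →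
      ValidFrac q →
      ValidFrac (t.foldl (fun q e => if e.1 = v then minFrac q e.2 else q) q) ∧
      (∀ W, FracLE q W →
        FracLE (t.foldl (fun q e => if e.1 = v then minFrac q e.2 else q) q) W) ∧
      ∀ W, ∀ e ∈ t, e.1 = v → FracLE e.2 W →
        FracLE (t.foldl (fun q e => if e.1 = v then minFrac q e.2 else q) q) W := by
    intro t
    induction t with
    | nil => exact fun q _ hq => ⟨hq, fun _ h => h, by simp⟩
    | cons e t ih =>
      intro q ht hq
      have he := ht e List.mem_cons_self
      have hq' : ValidFrac (if e.1 = v then minFrac q e.2 else q) := by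
        split_ifs
        exacts [hq.minFrac he, hq]
      obtain ⟨h1, h2, h3⟩ := ih _ (fun e he => ht e (List.mem_cons_of_mem _ he)) hq'
      refine ⟨h1, fun W hW => h2 W ?_, fun W e' he' hv hW => ?_⟩
      · split_ifs
        exacts [hW.minFrac_left hq, hW]
      · rcases List.mem_cons.1 he' with rfl | he'
        · exact h2 W (by rw [if_pos hv]; exact hW.minFrac_right he)
        · exact h3 W e' he' hv hW
  obtain ⟨h1, -, h2⟩ := key t (1, 0) ht (.inl one_pos)
  exact ⟨h1, h2⟩

/-- The lists of fields that `fld` gives for atoms represent these atoms, if variables are named by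
`name` and the approximations have the weights `w`. -/
structure Represents {V α : Type} (name : V → List Bool) (w : α → ℚ)
    (fld : Atom V α → List (List Bool)) : Prop where
  lhs : ∀ a, fieldLhs (fld a) = name a.lhs
  rhs : ∀ a, fieldRhs (fld a) = name a.rhs
  num : ∀ a, (fieldNum (fld a) : ℚ) = w a.approx * fieldDen (fld a)
  den : ∀ a, 0 < fieldDen (fld a)

namespace Represents

variable {V α : Type} {name : V → List Bool} {w : α → ℚ} {fld : Atom V α → List (List Bool)}

/-- Every entry of the table comes from a walk. -/
theorem sound (hf : Represents name w fld) (hname : Injective name) {S : Set (Atom V α)} {y : V}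
    (m : List (Atom V α)) :
    ∀ t : List (List Bool × ℕ × ℕ), (∀ a ∈ m, a ∈ S) →
    (∀ e ∈ t, ValidFrac e.2 ∧ (0 < e.2.2 → ∃ u l W, name u = e.1 ∧ Walk w S y l u W ∧
      W * e.2.2 ≤ e.2.1)) →
    ∀ e ∈ (m.map fld).foldl relax t, ValidFrac e.2 ∧ (0 < e.2.2 → ∃ u l W, name u = e.1 ∧
      Walk w S y l u W ∧ W * e.2.2 ≤ e.2.1) := by
  induction m with
  | nil => exact fun t _ ht => ht
  | cons a m ih =>
    intro t hm ht
    refine ih (relax t (fld a)) (fun b hb => hm b (List.mem_cons_of_mem _ hb)) fun e he => ?_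
    rcases List.mem_cons.1 he with rfl | he
    · have hv := (lookup_spec (v := fieldRhs (fld a)) fun e he => (ht e he).1).1
      have hd := hf.den a
      refine ⟨?_, fun hpos => ?_⟩
      · rcases hv with hv | hv
        · exact .inl (Nat.add_pos_left (Nat.mul_pos hv hd) _)
        · exact .inr (Nat.mul_pos hv hd)
      · have hpos' := Nat.pos_of_mul_pos_right hpos
        rcases lookup_mem (fieldRhs (fld a)) t with h | h
        · rw [h] at hpos'
          exact absurd hpos' (lt_irrefl _)
        · obtain ⟨u, l, W, h1, h2, h3⟩ := (ht _ h).2 hpos'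
          have hu : u = a.rhs := hname (h1.trans (hf.rhs a))
          subst hu
          refine ⟨_, _, _, (hf.lhs a).symm, .step (hm a List.mem_cons_self) h2, ?_⟩
          have h4 := hf.num a
          push_cast at h3 ⊢
          rw [h4]
          have h5 := mul_le_mul_of_nonneg_right h3 (Nat.cast_nonneg (α := ℚ) (fieldDen (fld a)))
          linarith
    · exact ht e he

theorem valid (hf : Represents name w fld) (m : List (Atom V α)) :
    ∀ t : List (List Bool × ℕ × ℕ), (∀ e ∈ t, ValidFrac e.2) →
    ∀ e ∈ (m.map fld).foldl relax t, ValidFrac e.2 := by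
  induction m with
  | nil => exact fun t ht => ht
  | cons a m ih =>
    refine fun t ht => ih _ fun e he => ?_
    rcases List.mem_cons.1 he with rfl | he
    · have hd := hf.den a
      rcases (lookup_spec (v := fieldRhs (fld a)) ht).1 with hv | hv
      · exact .inl (Nat.add_pos_left (Nat.mul_pos hv hd) _)
      · exact .inr (Nat.mul_pos hv hd)
    · exact ht e he

/-- After `r` rounds the table accounts for all walks with at most `r` edges. -/
def Complete (name : V → List Bool) (w : α → ℚ) (S : Set (Atom V α)) (y : V) (r : ℕ)
    (t : List (List Bool × ℕ × ℕ)) : Prop :=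
  ∀ l u W, Walk w S y l u W → l.length ≤ r → ∃ e ∈ t, e.1 = name u ∧ FracLE e.2 W

theorem subset_foldl_relax (es : List (List (List Bool))) (t : List (List Bool × ℕ × ℕ)) :
    t ⊆ es.foldl relax t := by
  induction es generalizing t with
  | nil => exact List.Subset.refl _
  | cons e es ih => exact fun x hx => ih _ (List.mem_cons_of_mem _ hx)

theorem complete_succ (hf : Represents name w fld) {m : List (Atom V α)} {y : V} {r : ℕ}
    {t : List (List Bool × ℕ × ℕ)} (ht : ∀ e ∈ t, ValidFrac e.2)
    (h : Complete name w {a | a ∈ m} y r t) :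
    Complete name w {a | a ∈ m} y (r + 1) ((m.map fld).foldl relax t) := by
  intro l u W hW hl
  cases hW with
  | refl =>
    obtain ⟨e, he, h1⟩ := h _ _ _ .refl (Nat.zero_le _)
    exact ⟨e, subset_foldl_relax _ _ he, h1⟩
  | @step a l W ha hW =>
    obtain ⟨m₁, m₂, rfl⟩ := List.append_of_mem ha
    -- the table at the moment when the first edge of the walk is processed
    have hv := hf.valid m₁ t ht
    obtain ⟨e, he, h1, h2⟩ := h _ _ _ hW (by simpa using hl)
    have h3 := (lookup_spec (v := fieldRhs (fld a)) hv).2 W e (subset_foldl_relax _ _ he)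
      (h1.trans (hf.rhs a).symm) h2
    have h4 : FracLE ((lookup (fieldRhs (fld a)) ((m₁.map fld).foldl relax t)).1 *
        fieldDen (fld a) + fieldNum (fld a) *
          (lookup (fieldRhs (fld a)) ((m₁.map fld).foldl relax t)).2,
        (lookup (fieldRhs (fld a)) ((m₁.map fld).foldl relax t)).2 * fieldDen (fld a))
        (w a.approx + W) := by
      rw [FracLE] at h3 ⊢
      push_cast
      rw [hf.num a]
      have h5 := mul_le_mul_of_nonneg_right h3 (Nat.cast_nonneg (α := ℚ) (fieldDen (fld a)))
      linarith
    have h5 : (fieldLhs (fld a), (lookup (fieldRhs (fld a)) ((m₁.map fld).foldl relax t)).1 *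
        fieldDen (fld a) + fieldNum (fld a) *
          (lookup (fieldRhs (fld a)) ((m₁.map fld).foldl relax t)).2,
        (lookup (fieldRhs (fld a)) ((m₁.map fld).foldl relax t)).2 * fieldDen (fld a)) ∈
        relax ((m₁.map fld).foldl relax t) (fld a) := List.mem_cons_self
    have h6 := subset_foldl_relax (m₂.map fld) _ h5
    rw [← List.foldl_cons, ← List.foldl_append, ← List.map_cons, ← List.map_append] at h6
    exact ⟨_, h6, hf.lhs a, h4⟩

theorem complete_rounds (hf : Represents name w fld) (m : List (Atom V α)) (y : V) :
    Complete name w {a | a ∈ m} y m.length (distances (name y) (m.map fld)) := by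
  have key : ∀ (k m' : List (List (List Bool))) (r : ℕ),
      (∀ r₀ t, (∀ e ∈ t, ValidFrac e.2) → Complete name w {a | a ∈ m} y r₀ t →
        Complete name w {a | a ∈ m} y (r₀ + r) (m'.foldl relax t)) →
      ∀ r₀ t, (∀ e ∈ t, ValidFrac e.2) → Complete name w {a | a ∈ m} y r₀ t →
        Complete name w {a | a ∈ m} y (r₀ + (r + k.length))
          ((k.foldl (fun m' _ => m.map fld ++ m') m').foldl relax t) := by
    intro k
    induction k with
    | nil => exact fun m' r h => h
    | cons b k ih =>
      intro m' r h
      rw [List.foldl_cons, List.length_cons, add_comm k.length, ← add_assoc]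
      refine ih _ (r + 1) fun r₀ t ht hc => ?_
      rw [List.foldl_append, add_comm r, ← add_assoc]
      exact h _ _ (hf.valid m t ht) (hf.complete_succ ht hc)
  have := key (m.map fld) [] 0 (fun r₀ t _ h => h) 0 [(name y, 0, 1)] (by simp [ValidFrac]) ?_
  · simp only [List.length_map, zero_add] at this
    exact this
  · intro l u W h hl
    cases h with
    | refl => exact ⟨_, List.mem_cons_self, rfl, by simp [FracLE]⟩
    | step => simp at hl

/-- The best bound in the final table is at most the weight of an atom if and only if there is a
walk of at most this weight. -/
theorem lookup_distances_iff (hf : Represents name w fld) (hname : Injective name)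
    (hw : ∀ p, 0 ≤ w p) (m : List (Atom V α)) (g : Atom V α) :
    (lookup (name g.lhs) (distances (name g.rhs) (m.map fld))).1 * fieldDen (fld g) ≤
      fieldNum (fld g) * (lookup (name g.lhs) (distances (name g.rhs) (m.map fld))).2 ↔
    ∃ l W, Walk w {a | a ∈ m} g.rhs l g.lhs W ∧ W ≤ w g.approx := by
  have hsound : ∀ e ∈ distances (name g.rhs) (m.map fld), ValidFrac e.2 ∧ (0 < e.2.2 →
      ∃ u l W, name u = e.1 ∧ Walk w {a | a ∈ m} g.rhs l u W ∧ W * e.2.2 ≤ e.2.1) := by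
    have : ∃ m' : List (Atom V α), rounds (m.map fld) = m'.map fld ∧ ∀ a ∈ m', a ∈ m := by
      have key : ∀ k m' : List (Atom V α), (∀ a ∈ m', a ∈ m) → ∃ m'' : List (Atom V α),
          (k.map fld).foldl (fun m' _ => m.map fld ++ m') (m'.map fld) = m''.map fld ∧
            ∀ a ∈ m'', a ∈ m := by
        intro k
        induction k with
        | nil => exact fun m' h => ⟨m', rfl, h⟩
        | cons b k ih =>
          intro m' h
          obtain ⟨m'', h1, h2⟩ := ih (m ++ m') fun a ha =>
            (List.mem_append.1 ha).elim (fun h => h) (h a)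
          exact ⟨m'', by rw [← h1, List.map_cons, List.foldl_cons, List.map_append], h2⟩
      exact key m [] (by simp)
    obtain ⟨m', h1, h2⟩ := this
    rw [distances, h1]
    refine hf.sound hname m' _ h2 fun e he => ?_
    obtain rfl := List.mem_singleton.1 he
    exact ⟨.inr one_pos, fun _ => ⟨_, _, _, rfl, .refl, by simp⟩⟩
  obtain ⟨hv, hmin⟩ := lookup_spec (v := name g.lhs) fun e he => (hsound e he).1
  generalize hd : lookup (name g.lhs) (distances (name g.rhs) (m.map fld)) = d at *
  have hden : (0 : ℚ) < fieldDen (fld g) := by exact_mod_cast hf.den g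
  constructor
  · intro h
    have hpos : 0 < d.2 := by
      by_contra h0
      have h1 : d.2 = 0 := by omega
      rw [h1, mul_zero] at h
      rcases hv with hv | hv
      · exact absurd (Nat.mul_pos hv (hf.den g)) (by omega)
      · omega
    rcases lookup_mem (name g.lhs) (distances (name g.rhs) (m.map fld)) with h1 | h1
    · rw [hd] at h1
      rw [h1] at hpos
      exact absurd hpos (lt_irrefl _)
    · rw [hd] at h1
      obtain ⟨u, l, W, h2, h3, h4⟩ := (hsound _ h1).2 hpos
      obtain rfl := hname h2
      refine ⟨l, W, h3, ?_⟩
      have h5 : (d.1 : ℚ) * fieldDen (fld g) ≤ fieldNum (fld g) * d.2 := by exact_mod_cast h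
      rw [hf.num g] at h5
      have h6 : (0 : ℚ) < d.2 := by exact_mod_cast hpos
      have h7 := mul_le_mul_of_nonneg_right h4 hden.le
      refine le_of_mul_le_mul_right ?_ (mul_pos h6 hden)
      linarith
  · rintro ⟨l, W, h1, h2⟩
    obtain ⟨l', W', h3, h4, h5⟩ := h1.exists_nodup hw
    have hlen : l'.length ≤ m.length := by
      have hsub : l' ⊆ m.map Atom.lhs := fun v hv => by
        obtain ⟨a, ha, rfl⟩ := h3.subset v hv
        exact List.mem_map_of_mem ha
      simpa using (h5.subperm hsub).length_le
    obtain ⟨e, he, h6, h7⟩ := hf.complete_rounds m g.rhs _ _ _ h3 hlen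
    have h8 : (d.1 : ℚ) ≤ W' * d.2 := hmin W' e he h6 h7
    have h9 : (d.1 : ℚ) * fieldDen (fld g) ≤ fieldNum (fld g) * d.2 := by
      rw [hf.num g]
      have h10 : W' * d.2 ≤ w g.approx * d.2 := by gcongr; linarith
      have h11 := mul_le_mul_of_nonneg_right (h8.trans h10) hden.le
      linarith
    exact_mod_cast h9

end Represents

/-! ### Entailment and walks -/

section entailment

variable {V M α : Type}

theorem Team.finite_values (T : Team V M) (x : V) : (T.values x).Finite :=
  (Finset.finite_toSet T).image _

theorem Team.ncard_values_diff_le_card (T : Team V M) (x y : V) :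
    (T.values x \ T.values y).ncard ≤ T.card := by
  refine (Set.ncard_le_ncard Set.sdiff_subset (T.finite_values x)).trans ?_
  simpa [Team.values] using Set.ncard_image_le (f := fun s : V → M => s x) (Finset.finite_toSet T)

/-- Atoms can be chained along a walk. -/
theorem Walk.ncard_le {w : α → ℚ} {S : Set (Atom V α)} {y : V} (T : Team V M) {c : ℚ}
    (h : ∀ a ∈ S, ((T.values a.lhs \ T.values a.rhs).ncard : ℚ) ≤ w a.approx * c)
    {l : List V} {u : V} {W : ℚ} (hW : Walk w S y l u W) :
    ((T.values u \ T.values y).ncard : ℚ) ≤ W * c := by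
  induction hW with
  | refl => simp
  | @step a l W ha _ ih =>
    have h1 : (T.values a.lhs \ T.values y).ncard ≤
        (T.values a.lhs \ T.values a.rhs).ncard + (T.values a.rhs \ T.values y).ncard := by
      refine (Set.ncard_le_ncard (fun z hz => ?_) (((T.finite_values _).sdiff).union
        ((T.finite_values _).sdiff))).trans (Set.ncard_union_le _ _)
      by_cases h : z ∈ T.values a.rhs
      exacts [.inr ⟨h, hz.2⟩, .inl ⟨hz.1, h⟩]
    have h2 : ((T.values a.lhs \ T.values y).ncard : ℚ) ≤
        (T.values a.lhs \ T.values a.rhs).ncard + (T.values a.rhs \ T.values y).ncard := by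
      exact_mod_cast h1
    have := h a ha
    linarith

/-- The function `f` is the distance to `y`, in multiples of `1 / D` and capped at `cap`. -/
theorem exists_potential {w : α → ℚ} {S : Set (Atom V α)} {x y : V} {D : ℕ} (hD : 0 < D)
    (hS : ∀ a ∈ S, ∃ j : ℕ, w a.approx * D = j) {t : ℚ} {cap : ℕ} (hcap : t * D < cap)
    (hx : ∀ l W, Walk w S y l x W → t < W) :
    ∃ f : V → ℕ, f y = 0 ∧ t * D < f x ∧ (∀ u, f u ≤ cap) ∧
      ∀ a ∈ S, (f a.lhs : ℚ) ≤ f a.rhs + w a.approx * D := by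
  let A : V → Set ℕ := fun u => {k | k = cap ∨ ∃ l W, Walk w S y l u W ∧ W * D = k}
  have hA : ∀ u, sInf (A u) ∈ A u := fun u => Nat.sInf_mem ⟨cap, .inl rfl⟩
  have hle : ∀ u, sInf (A u) ≤ cap := fun u => Nat.sInf_le (.inl rfl)
  refine ⟨fun u => sInf (A u), ?_, ?_, hle, fun a ha => ?_⟩
  · exact Nat.le_zero.1 (Nat.sInf_le (.inr ⟨_, _, .refl, by simp⟩))
  · rcases hA x with h | ⟨l, W, h1, h2⟩
    · simpa only [h] using hcap
    · simp only [← h2]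
      have : (0 : ℚ) < D := by exact_mod_cast hD
      have := hx l W h1
      gcongr
  · obtain ⟨j, hj⟩ := hS a ha
    rcases hA a.rhs with h | ⟨l, W, h1, h2⟩
    · have := hle a.lhs
      simp only [h, hj]
      exact_mod_cast this.trans (Nat.le_add_right _ _)
    · have : sInf (A a.lhs) ≤ sInf (A a.rhs) + j :=
        Nat.sInf_le (.inr ⟨_, _, .step ha h1, by push_cast; rw [← h2, ← hj]; ring⟩)
      simp only [hj]
      exact_mod_cast this

open Classical in
/-- The team of the assignments `u ↦ h u i` for `i < N`. -/
noncomputable def rangeTeam (N : ℕ) (h : V → ℕ → ℕ) : Team V ℕ :=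
  (Finset.range N).image fun i u => h u i

open Classical in
theorem ncard_rangeTeam {N : ℕ} {h : V → ℕ → ℕ} {g : V → ℕ}
    (hg : ∀ u, h u '' Set.Iio N = Set.Iio (g u)) (u v : V) :
    ((rangeTeam N h).values u \ (rangeTeam N h).values v).ncard = g u - g v := by
  have hval : ∀ u, (rangeTeam N h).values u = Set.Iio (g u) := by
    intro u
    rw [← hg, Team.values, rangeTeam, Finset.coe_image, Set.image_image, Finset.coe_range]
  have : Set.Iio (g u) \ Set.Iio (g v) = (Finset.Ico (g v) (g u) : Set ℕ) := by
    ext z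
    simp
  rw [hval, hval, this, Set.ncard_coe_finset, Nat.card_Ico]

theorem image_mod {g N : ℕ} (h0 : 0 < g) (h : g ≤ N) :
    (fun i => i % g) '' Set.Iio N = Set.Iio g := by
  ext z
  constructor
  · rintro ⟨i, -, rfl⟩
    exact Nat.mod_lt _ h0
  · exact fun hz => ⟨z, hz.trans_le h, Nat.mod_eq_of_lt hz⟩

theorem entailsQuantity_iff (S : Set (Atom V ℕ)) (g : Atom V ℕ) :
    EntailsQuantity S g ↔
      ∃ l W, Walk (fun n : ℕ => (n : ℚ)) S g.rhs l g.lhs W ∧ W ≤ g.approx := by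
  constructor
  · intro h
    by_contra hno
    push Not at hno
    obtain ⟨f, hy, hx, hcap, hf⟩ := exists_potential (w := fun n : ℕ => (n : ℚ)) (S := S)
      (x := g.lhs) (y := g.rhs) (D := 1) one_pos (fun a _ => ⟨a.approx, by simp⟩)
      (t := g.approx) (cap := g.approx + 1) (by push_cast; linarith) hno
    -- the set of values of `u` has `f u + 1` elements, and these sets form a chain
    have hT := ncard_rangeTeam (N := g.approx + 2) (h := fun u i => i % (f u + 1))
      (g := fun u => f u + 1) fun u => image_mod (Nat.succ_pos _) (by have := hcap u; omega)
    have := h ℕ (rangeTeam (g.approx + 2) fun u i => i % (f u + 1)) fun a ha => by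
      rw [SatQuantity, hT]
      have := hf a ha
      simp only [Nat.cast_one, mul_one] at this
      have : f a.lhs ≤ f a.rhs + a.approx := by exact_mod_cast this
      omega
    rw [SatQuantity, hT, hy] at this
    simp only [Nat.cast_one, mul_one] at hx
    have : g.approx < f g.lhs := by exact_mod_cast hx
    omega
  · rintro ⟨l, W, h1, h2⟩ M T hT
    have h3 := h1.ncard_le T (c := 1) fun a ha => by
      have := hT a ha
      rw [SatQuantity] at this
      rw [mul_one]
      exact_mod_cast this
    rw [mul_one] at h3
    rw [SatQuantity]
    exact_mod_cast h3.trans h2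

theorem exists_common_den (m : List (Atom V Ratio)) :
    ∃ D : ℕ, 0 < D ∧ ∀ a ∈ m, ∃ j : ℕ, (a.approx : ℚ) * D = j := by
  induction m with
  | nil => exact ⟨1, one_pos, by simp⟩
  | cons a m ih =>
    obtain ⟨D, hD, h⟩ := ih
    refine ⟨a.approx.1.den * D, Nat.mul_pos a.approx.1.den_pos hD, fun b hb => ?_⟩
    rcases List.mem_cons.1 hb with rfl | hb
    · refine ⟨b.approx.1.num.natAbs * D, ?_⟩
      have h1 : ((b.approx.1.num.natAbs : ℕ) : ℚ) = b.approx.1.num := by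
        rw [Nat.cast_natAbs, abs_of_nonneg (Rat.num_nonneg.2 b.approx.2.1)]
      push_cast
      rw [← mul_assoc, Rat.mul_den_eq_num, h1]
    · obtain ⟨j, hj⟩ := h b hb
      exact ⟨a.approx.1.den * j, by push_cast; rw [← hj]; ring⟩

theorem entailsRatio_iff (m : List (Atom V Ratio)) (g : Atom V Ratio) :
    EntailsRatio {a | a ∈ m} g ↔ 1 ≤ (g.approx : ℚ) ∨
      ∃ l W, Walk (fun p : Ratio => (p : ℚ)) {a | a ∈ m} g.rhs l g.lhs W ∧ W ≤ g.approx := by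
  constructor
  · intro h
    by_contra hno
    push Not at hno
    obtain ⟨hp, hno⟩ := hno
    have hp0 : (0 : ℚ) ≤ g.approx := g.approx.2.1
    have hne : g.lhs ≠ g.rhs := by
      intro he
      have := hno [] 0 (he ▸ .refl)
      linarith
    obtain ⟨D, hD, hden⟩ := exists_common_den (g :: m)
    have hD' : (0 : ℚ) < D := by exact_mod_cast hD
    obtain ⟨j₀, hj₀⟩ := hden g List.mem_cons_self
    obtain ⟨f, hy, hx, hcap, hf⟩ := exists_potential (w := fun p : Ratio => (p : ℚ))
      (S := {a | a ∈ m}) (x := g.lhs) (y := g.rhs) hD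
      (fun a ha => hden a (List.mem_cons_of_mem _ ha))
      (t := g.approx) (cap := D) (by nlinarith) hno
    rw [hj₀] at hx
    have hx : j₀ < f g.lhs := by exact_mod_cast hx
    -- The team has `D * K` assignments, and `max (f u * K) c` values of `u`. The `c` values of the
    -- right-hand side of the goal, which are fewer than `K`, make the assignments distinct: the
    -- quotient and the remainder by `f g.lhs * K` determine the index.
    obtain ⟨K, hK⟩ : ∃ K, K = D + 1 := ⟨_, rfl⟩
    obtain ⟨c, hc⟩ : ∃ c, c = (D - 1) / f g.lhs + 1 := ⟨_, rfl⟩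
    have hcD : c ≤ D := by
      have := Nat.div_le_self (D - 1) (f g.lhs)
      omega
    have hxK : K ≤ f g.lhs * K := Nat.le_mul_of_pos_left _ (by omega)
    have hgx : max (f g.lhs * K) c = f g.lhs * K := max_eq_left (by omega)
    classical
    obtain ⟨v, hv⟩ : ∃ v : V → ℕ → ℕ, v = fun u i =>
      if u = g.rhs then i / (f g.lhs * K) else i % max (f u * K) c := ⟨_, rfl⟩
    have himage : ∀ u, v u '' Set.Iio (D * K) = Set.Iio (max (f u * K) c) := by
      intro u
      by_cases hu : u = g.rhs
      · subst hu
        have : v g.rhs = fun i => i / (f g.lhs * K) := by funext i; simp [hv]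
        rw [this, hy, zero_mul, max_eq_right (Nat.zero_le _)]
        ext z
        simp only [Set.mem_image, Set.mem_Iio]
        constructor
        · rintro ⟨i, hi, rfl⟩
          have h1 : i / K ≤ D - 1 := by
            have := (Nat.div_lt_iff_lt_mul (by omega)).2 hi
            omega
          have h2 := Nat.div_le_div_right (c := f g.lhs) h1
          rw [Nat.div_div_eq_div_mul, mul_comm K] at h2
          omega
        · intro hz
          refine ⟨z * (f g.lhs * K), ?_, Nat.mul_div_cancel _ (by omega)⟩
          have h1 : z * f g.lhs ≤ D - 1 := (Nat.le_div_iff_mul_le (by omega)).1 (by omega)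
          have h2 := Nat.mul_le_mul_right K h1
          have h3 : (D - 1) * K < D * K := Nat.mul_lt_mul_of_pos_right (by omega) (by omega)
          rw [← mul_assoc]
          omega
      · have : v u = fun i => i % max (f u * K) c := by funext i; simp [hv, hu]
        rw [this]
        refine image_mod ((show 0 < c from hc ▸ Nat.succ_pos _).trans_le (le_max_right _ _))
          (max_le ?_ ?_)
        · exact Nat.mul_le_mul_right _ (hcap u)
        · exact hcD.trans (Nat.le_mul_of_pos_right _ (by omega))
    have hcard : (rangeTeam (D * K) v).card = D * K := by
      rw [rangeTeam, Finset.card_image_of_injOn, Finset.card_range]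
      intro i _ j _ hij
      have h1 := congrFun hij g.rhs
      have h2 := congrFun hij g.lhs
      simp only [hv, if_true, hne, if_false, hgx] at h1 h2
      rw [← Nat.div_add_mod i (f g.lhs * K), h1, h2, Nat.div_add_mod]
    have hT := ncard_rangeTeam himage
    have := h ℕ (rangeTeam (D * K) v) fun a ha => by
      obtain ⟨j, hj⟩ := hden a (List.mem_cons_of_mem _ ha)
      have h1 := hf a ha
      rw [hj] at h1
      have h1 : f a.lhs ≤ f a.rhs + j := by exact_mod_cast h1
      have h2 := Nat.mul_le_mul_right K h1
      rw [add_mul] at h2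
      have h3 : max (f a.lhs * K) c - max (f a.rhs * K) c ≤ j * K := by omega
      rw [SatRatio, hT, hcard]
      push_cast [← mul_assoc, hj]
      exact_mod_cast h3
    rw [SatRatio, hT, hcard, hgx, hy, zero_mul, max_eq_right (Nat.zero_le _)] at this
    push_cast [← mul_assoc, hj₀] at this
    have h1 : f g.lhs * K - c ≤ j₀ * K := by exact_mod_cast this
    have h2 := Nat.mul_le_mul_right K hx
    rw [Nat.succ_mul] at h2
    omega
  · rintro (h | ⟨l, W, h1, h2⟩) M T hT
    · have h1 : ((T.values g.lhs \ T.values g.rhs).ncard : ℚ) ≤ T.card := by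
        exact_mod_cast T.ncard_values_diff_le_card g.lhs g.rhs
      exact h1.trans (le_mul_of_one_le_left (Nat.cast_nonneg _) h)
    · exact (h1.ncard_le T hT).trans (by gcongr)

end entailment

/-! ### The Turing machine -/

namespace Prog

open Computability

theorem sz_symbol_le (x : Γ') : sz x ≤ 11 := by
  rcases x with _ | (_ | _) | _ | _ | _ <;> decide

/-- Puts the encoding of the symbol in the register on top of the main stack, if the symbol occurs
in the list. -/
def pushSymbol : List Γ' → Prog Stk Γ'
  | [] => pushData .nil
  | x :: l => ite (fun r => decide (r = some x)) (pushData (Enc.enc x)) (pushSymbol l)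

theorem exec_pushSymbol {l : List Γ'} {x : Γ'} (hx : x ∈ l) (i m : List Γ') :
    Exec (pushSymbol l) (some x, conf i m [] [] []) (11 + l.length)
      (some x, conf i ((Enc.enc x).word ++ m) [] [] []) := by
  induction l with
  | nil => simp at hx
  | cons z l ih =>
    by_cases h : x = z
    · subst h
      exact .mono (.ite_true (by simp) (exec_pushData (Enc.enc x) i m (some x))) (by
        have := sz_symbol_le x
        simp only [sz] at this
        simp only [List.length_cons]
        omega)
    · exact .mono (.ite_false (by simpa using h) (ih ((List.mem_cons.1 hx).resolve_left h)))
        (by simp only [List.length_cons]; omega)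

/-- The symbols of the alphabet. -/
def symbols : List Γ' := [.blank, .bit false, .bit true, .bra, .ket, .comma]

theorem mem_symbols (x : Γ') : x ∈ symbols := by
  rcases x with _ | (_ | _) | _ | _ | _ <;> decide

/-- Turns the word on the input stack into the encoding of the reversed word. -/
def loadProg : Prog Stk Γ' :=
  seq (push .main fun _ => .bit false) (seq (pop .inp)
    (loop Option.isSome (seq (pushSymbol symbols) (seq (push .main fun _ => .bit true)
      (pop .inp)))))

theorem exec_loadProg (v : List Γ') : Exec loadProg (none, conf v [] [] [] [])
    (20 * v.length + 3) (none, conf [] (Enc.enc v.reverse).word [] [] []) := by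
  have key : ∀ v u : List Γ', Exec (loop Option.isSome (seq (pushSymbol symbols)
      (seq (push .main fun _ => .bit true) (pop .inp))))
      (v.head?, conf v.tail (Enc.enc u).word [] [] []) (20 * v.length + 1)
      (none, conf [] (Enc.enc (v.reverse ++ u)).word [] [] []) := by
    intro v
    induction v with
    | nil => exact fun u => .loop_false rfl
    | cons x v ih =>
      intro u
      refine .mono (.loop_true rfl (.seq (exec_pushSymbol (mem_symbols x) _ _)
        (.seq (exec_push (S' := conf v (Enc.enc (x :: u)).word [] [] []) ?_)
          (exec_pop (r' := v.head?) (S' := conf v.tail (Enc.enc (x :: u)).word [] [] [])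
            rfl (by simp [conf])))) ((ih (x :: u)).cast rfl ?_))
        (m := 11 + symbols.length + (1 + 1) + (20 * v.length + 1) + 1) ?_
      · simp [conf, Enc.enc, encList, Data.word]
      · simp
      · simp only [symbols, List.length_cons, List.length_nil]
        omega
  refine .mono (.seq (exec_push (S' := conf v (Enc.enc ([] : List Γ')).word [] [] []) ?_)
    (.seq (exec_pop rfl (S' := conf v.tail (Enc.enc ([] : List Γ')).word [] [] []) ?_)
    ((key v []).cast rfl (by rw [List.append_nil])))) (by omega)
  · simp [conf, Enc.enc, encList, Data.word]
  · simp [conf]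

/-- The Turing machine that reads its input, runs a program, and writes the Boolean that the
program leaves on the main stack to the output stack. -/
@[reducible]
def machine (p : Prog Stk Γ') : Turing.FinTM2 where
  K := Option Stk
  k₀ := some .inp
  k₁ := none
  Γ := Alphabet Stk Γ'
  Λ := Option (Label (seq loadProg p))
  main := some (entry (seq loadProg p))
  ΛFin := @instFintypeOption _ (labelFintype (seq loadProg p))
  σ := Option Γ'
  initialState := none
  Γk₀Fin := inferInstanceAs (Fintype Γ')
  -- The two additional pops at the end remove the leaves below the node that encodes `true`; they
  -- have no effect for `false`. An output configuration also has to have the initial register.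
  m := fun l => match l with
    | some l => code (seq loadProg p) some none l
    | none => .pop (some .main) (fun _ x => x) (.push none (fun r => isNode r)
        (.pop (some .main) (fun r _ => r) (.pop (some .main) (fun r _ => r)
          (.load (fun _ => none) .halt))))

end Prog

open Prog in
/-- A problem is in PTIME if a polynomial time function decides it on reversed words. -/
theorem inPTIME_of_polyTime {ι : Type} (e : ι ↪ List Computability.Γ') {P : ι → Prop}
    {f : List Computability.Γ' → Bool} (hf : PolyTime f) (h : ∀ i, f (e i).reverse = true ↔ P i) :
    InPTIME e P := by
  classical
  obtain ⟨p, t, ⟨q, hq⟩, -, hp⟩ := hf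
  refine ⟨{
    tm := machine p
    inputAlphabet := Equiv.refl _
    outputAlphabet := Equiv.refl _
    time := 20 * Polynomial.X + 4 + q.comp (12 * Polynomial.X + 1)
    outputsFun := fun i => Classical.choice ?_ }⟩
  obtain ⟨r, hr⟩ := hp (e i).reverse [] none
  rw [List.append_nil] at hr
  obtain ⟨hrun⟩ := ((exec_loadProg (e i)).seq hr).evals (M := (machine p).m) [] some none
    fun l => rfl
  have hbool : f (e i).reverse = decide (P i) := by
    rw [Bool.eq_iff_iff, h, decide_eq_true_iff]
  have hhalt : Turing.TM2.step (machine p).m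
      ⟨some none, r, machineStacks (conf [] ((Enc.enc (f (e i).reverse)).word ++ []) [] [] []) []⟩ =
      some (Turing.haltList (machine p) [decide (P i)]) := by
    rw [hbool]
    simp only [Turing.TM2.step, Turing.TM2.stepAux, Turing.haltList]
    congr 2
    funext k
    cases hP : decide (P i) <;> rcases k with _ | (_ | _ | _ | _ | _) <;> rfl
  have hinit : Turing.initList (machine p) (e i) = ⟨some (some (entry (seq loadProg p))), none,
      machineStacks (conf (e i) [] [] [] []) []⟩ := by
    rw [Turing.initList]
    congr 1
    funext k
    rcases k with _ | (_ | _ | _ | _ | _) <;> rfl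
  have hall := hrun.trans _ (m₂ := 1) _ _ _ _ ⟨⟨1, hhalt⟩, le_rfl⟩
  have htime : 1 + (20 * (e i).length + 3 + t (e i).reverse) ≤
      (20 * Polynomial.X + 4 + q.comp (12 * Polynomial.X + 1)).eval (e i).length := by
    have h1 : sz (e i).reverse ≤ 12 * (e i).length + 1 := by
      have := sz_le_of_forall (l := (e i).reverse) fun x _ => sz_symbol_le x
      rw [List.length_reverse] at this
      omega
    have h2 := (hq (e i).reverse).trans (eval_mono q h1)
    simp only [Polynomial.eval_add, Polynomial.eval_mul, Polynomial.eval_X, Polynomial.eval_comp,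
      Polynomial.eval_ofNat, Polynomial.eval_one]
    omega
  have hin : List.map (Equiv.refl (Alphabet Stk Computability.Γ' (some Stk.inp))).invFun (e i) =
      e i := List.map_id _
  have hout : List.map (Equiv.refl (Alphabet Stk Computability.Γ' none)).invFun
      (Computability.encodeBool (decide (P i))) = [decide (P i)] := rfl
  refine ⟨⟨⟨hall.steps, ?_⟩, hall.steps_le_m.trans htime⟩⟩
  have := hall.evals_in_steps
  exact (congrArg (fun c => (flip bind (machine p).step)^[hall.steps] (some c))
    ((congrArg (Turing.initList (machine p)) hin).trans hinit)).trans this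

/-! ### The two implication problems -/

theorem polyTime_check_parse (ratio : Bool) :
    PolyTime fun l : List Computability.Γ' => check ratio (parse l.reverse) :=
  (polyTime_parse PolyTime.id.reverse).check ratio

theorem represents_quantity {V : Type} (name : V → List Bool) :
    Represents name (fun n : ℕ => (n : ℚ)) fun a : Atom V ℕ =>
      name a.lhs :: name a.rhs :: [a.approx.bits] where
  lhs _ := rfl
  rhs _ := rfl
  num a := by simp [fieldNum, fieldDen, ofBits_bits, ofBits_cons]
  den a := by simp [fieldDen, ofBits_cons]

theorem represents_ratio {V : Type} (name : V → List Bool) :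
    Represents name (fun p : Ratio => (p : ℚ)) fun a : Atom V Ratio =>
      name a.lhs :: name a.rhs :: [a.approx.1.num.natAbs.bits, a.approx.1.den.bits] where
  lhs _ := rfl
  rhs _ := rfl
  num a := by
    simp only [fieldNum, fieldDen, List.tail_cons, List.headD_cons, ofBits_bits]
    rw [Rat.mul_den_eq_num, Nat.cast_natAbs, abs_of_nonneg (Rat.num_nonneg.2 a.approx.2.1)]
  den a := by
    simp only [fieldDen, List.tail_cons, List.headD_cons, ofBits_bits]
    exact a.approx.1.den_pos

theorem inPTIME_entailsQuantity {V : Type} (name : V ↪ List Bool) :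
    InPTIME (quantityEncoding name) fun i => EntailsQuantity i.assumptionSet i.goal := by
  refine inPTIME_of_polyTime _ (polyTime_check_parse false) fun i => ?_
  have hparse := parse_inputWord (name := name) (w := quantityWord) (flds := fun n : ℕ => [n.bits])
    (by simp) (fun n => by rw [quantityWord, encodeNat_eq_bits]; rfl) i
  have hiff := (represents_quantity name).lookup_distances_iff name.injective
    (fun n => Nat.cast_nonneg n) i.assumptions i.goal
  rw [List.reverse_reverse]
  change check false (parse (inputWord name quantityWord i)) = true ↔ _
  rw [hparse, Input.assumptionSet, entailsQuantity_iff, ← hiff]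
  simp only [check, Bool.false_and, Bool.false_or, decide_eq_true_eq]
  rfl

theorem inPTIME_entailsRatio {V : Type} (name : V ↪ List Bool) :
    InPTIME (ratioEncoding name) fun i => EntailsRatio i.assumptionSet i.goal := by
  refine inPTIME_of_polyTime _ (polyTime_check_parse true) fun i => ?_
  have hparse := parse_inputWord (name := name) (w := ratioWord)
    (flds := fun p : Ratio => [p.1.num.natAbs.bits, p.1.den.bits])
    (by simp) (fun p => by rw [ratioWord, encodeNat_eq_bits, encodeNat_eq_bits]; rfl) i
  have hrep := represents_ratio name
  have hiff := hrep.lookup_distances_iff name.injective (fun p => p.2.1) i.assumptions i.goal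
  have hone : (1 : ℚ) ≤ i.goal.approx ↔
      fieldDen (name i.goal.lhs :: name i.goal.rhs ::
        [i.goal.approx.1.num.natAbs.bits, i.goal.approx.1.den.bits]) ≤
      fieldNum (name i.goal.lhs :: name i.goal.rhs ::
        [i.goal.approx.1.num.natAbs.bits, i.goal.approx.1.den.bits]) := by
    rw [← Nat.cast_le (α := ℚ), hrep.num i.goal]
    exact (le_mul_iff_one_le_left (Nat.cast_pos.2 (hrep.den i.goal))).symm
  rw [List.reverse_reverse]
  change check true (parse (inputWord name ratioWord i)) = true ↔ _
  rw [hparse, Input.assumptionSet, entailsRatio_iff, hone, ← hiff]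
  simp only [check, Bool.true_and, Bool.or_eq_true, decide_eq_true_eq]
  rfl

end ApproxInclusion

theorem theorem4 (V : Type) (name : V ↪ List Bool) :
    ApproxInclusion.InPTIME (ApproxInclusion.quantityEncoding name)
      (fun i => ApproxInclusion.EntailsQuantity i.assumptionSet i.goal) ∧
    ApproxInclusion.InPTIME (ApproxInclusion.ratioEncoding name)
      (fun i => ApproxInclusion.EntailsRatio i.assumptionSet i.goal) :=
  ⟨ApproxInclusion.inPTIME_entailsQuantity name, ApproxInclusion.inPTIME_entailsRatio name⟩
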